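/- Let $T=\mathbb C^3/\Lambda$ be a complex torus of dimension $3$, and let $G$ be a finite group acting holomorphically on $T$ such that no non-trivial element of $G$ acts as a translation and such that only finitely many points of $T$ have a non-trivial stabilizer. Assume that the quotient $X=T/G$ has canonical singularities. (The action is not required to be rigid.) Then: 1. For every $p\in T$ the stabilizer $\mathrm{Stab}(p)\subseteq G$ is cyclic of order $1,2,3,4,6,7,9$ or $14$. 2. The quotient $X$ has only isolated cyclic quotient singularities. More precisely, the singular points of $X$ are isolated; $X$ is smooth at the image of every point $p$ with trivial stabilizer; and for every $p\in T$ with non-trivial stabilizer of order $d$, the quotient $X$ has at the image of $p$ a cyclic quotient singularity of one of the types $$\tfrac1d(1,1,d-1)\ \text{ with } d\in\{2,3,4,6\},\qquad \tfrac13(1,1,1),\qquad \tfrac17(1,2,4),\qquad \tfrac19(1,4,7),\qquad \tfrac1{14}(1,9,11).$$ Here $X$ has at $x$ a cyclic quotient singularity of type $\tfrac1d(a_1,a_2,a_3)$ if the germ $(X,x)$ is biholomorphic to the germ at the image of the origin of $\mathbb C^3/\mu_d$, where the group $\mu_d$ of $d$-th roots of unity acts by $\zeta\cdot(z_1,z_2,z_3)=(\zeta^{a_1}z_1,\zeta^{a_2}z_2,\zeta^{a_3}z_3)$.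 -/

import Mathlib

open Filter Topology

/-- The complex vector space `ℂ³` (only its topological and linear structure is used). -/
abbrev C3 : Type := Fin 3 → ℂ

/-! ### Quotients of `ℂ³` as complex spaces

A (reduced) complex space `X` which is a quotient of `ℂ³` is given by its quotient map
`q : ℂ³ → X`. Its structure sheaf consists of the complex valued functions whose pullback along `q`
is holomorphic; for a quotient of a manifold by a properly discontinuous group this is the usual
structure of a complex space on the quotient (the sheaf of invariant holomorphic functions).
The space `ℂ³` itself is the case `q = id`. -/

section ComplexSpaces

variable {X Y : Type*}

/-- The function `h` represents a germ at `x` of the structure sheaf of `X`: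
its pullback to `ℂ³` is holomorphic at every point over `x`. -/
def HolFunAt (q : C3 → X) (x : X) (h : X → ℂ) : Prop :=
  ∀ z : C3, q z = x → AnalyticAt ℂ (h ∘ q) z

variable [TopologicalSpace X] [TopologicalSpace Y]

/-- The map `f : X → Y` is holomorphic at `x`: it is continuous there and pulls germs of holomorphic
functions at `f x` back to germs of holomorphic functions at `x`. A map is holomorphic on an open
set when it is so at each of its points. -/
def HolMapAt (q : C3 → X) (q' : C3 → Y) (f : X → Y) (x : X) : Prop :=
  ContinuousAt f x ∧ ∀ h : Y → ℂ, HolFunAt q' (f x) h → HolFunAt q x (h ∘ f)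

/-- The germs `(X, x)` and `(Y, y)` are biholomorphic: some open neighbourhood of `x` is
mapped biholomorphically onto an open neighbourhood of `y`, with `x` going to `y`. -/
def GermBiholomorphic (q : C3 → X) (x : X) (q' : C3 → Y) (y : Y) : Prop :=
  ∃ e : OpenPartialHomeomorph X Y, x ∈ e.source ∧ e x = y ∧
    (∀ x' ∈ e.source, HolMapAt q q' e x') ∧ (∀ y' ∈ e.target, HolMapAt q' q e.symm y')

/-- `x` is a smooth point of `X`: the germ of `X` at `x` is that of `ℂ³` at the origin. -/
def SmoothPoint (q : C3 → X) (x : X) : Prop :=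
  GermBiholomorphic q x (id : C3 → C3) 0

end ComplexSpaces

/-! ### Cyclic quotient singularities -/

/-- The orbit relation of the action of the group `μ_d` of `d`-th roots of unity on `ℂ³` given by
`ζ • (z₁, z₂, z₃) = (ζ ^ a₁ z₁, ζ ^ a₂ z₂, ζ ^ a₃ z₃)`. -/
def cyclicSetoid (d : ℕ) (a : Fin 3 → ℕ) : Setoid C3 where
  r z w := ∃ ζ ∈ rootsOfUnity d ℂ, ∀ i, w i = (ζ : ℂ) ^ a i * z i
  iseqv :=
    { refl := fun _ => ⟨1, one_mem _, fun _ => by simp⟩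
      symm := by
        rintro z w ⟨ζ, hζ, h⟩
        refine ⟨ζ⁻¹, inv_mem hζ, fun i => ?_⟩
        rw [h i, ← mul_assoc, ← mul_pow]
        simp
      trans := by
        rintro x y z ⟨ζ, hζ, h⟩ ⟨ξ, hξ, k⟩
        refine ⟨ξ * ζ, mul_mem hξ hζ, fun i => ?_⟩
        rw [k i, h i]
        push_cast
        ring }

/-- The quotient map `ℂ³ → ℂ³ / μ_d` for the action with weights `a`. -/
def cyclicMk (d : ℕ) (a : Fin 3 → ℕ) : C3 → Quotient (cyclicSetoid d a) :=
  fun z => Quotient.mk (cyclicSetoid d a) z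

/-- `X` has at `x` a cyclic quotient singularity of type `1/d (a₁, a₂, a₃)`: its germ there is
biholomorphic to the germ of `ℂ³ / μ_d` at the image of the origin. -/
def IsCyclicQuotientPoint {X : Type*} [TopologicalSpace X] (q : C3 → X) (x : X)
    (d : ℕ) (a : Fin 3 → ℕ) : Prop :=
  GermBiholomorphic q x (cyclicMk d a) (cyclicMk d a 0)

/-! ### Canonical singularities

In this part `q : ℂ³ → X` is the quotient map by a properly discontinuous group of affine
transformations whose non-trivial elements fix no hypersurface. Then the unramified locus `X°` of
`q` consists of smooth points and its complement has codimension at least two in `X`, so that a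
section over an open set `V` of the reflexive pluricanonical sheaf `ω_X^[r]` is the same thing as a
section of `ω^r` over `V ∩ X°`. -/

section Canonical

variable {X : Type*}

/-- The open set `X°` of points of `X` over which `q` is unramified, i.e. locally injective. -/
def unramifiedLocus (q : C3 → X) : Set X :=
  {x | ∀ z : C3, q z = x → ∃ W ∈ 𝓝 z, Set.InjOn q W}

/-- The function `F` represents a holomorphic lift of `φ` through `q` at `w`. -/
def IsLiftAt (q : C3 → X) (φ : C3 → X) (F : C3 → C3) (w : C3) : Prop :=
  AnalyticAt ℂ F w ∧ ∀ᶠ w' in 𝓝 w, q (F w') = φ w'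

/-- A local generator of the pluricanonical sheaf `ω_X^[r]` over `V`, that is, a nowhere vanishing
section of `ω^r` over `V ∩ X°`. It is given by its pullback `η (dz₁ ∧ dz₂ ∧ dz₃) ^ r` to `ℂ³`: a
holomorphic form without zeros over `V ∩ X°` which is invariant under the local deck
transformations of `q`. -/
structure IsPluricanonicalGenerator (q : C3 → X) (r : ℕ) (V : Set X) (η : C3 → ℂ) : Prop where
  holomorphic : ∀ z, q z ∈ V ∩ unramifiedLocus q → AnalyticAt ℂ η z
  ne_zero : ∀ z, q z ∈ V ∩ unramifiedLocus q → η z ≠ 0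
  invariant : ∀ z, q z ∈ V ∩ unramifiedLocus q → ∀ F : C3 → C3, IsLiftAt q q F z →
    η (F z) * (fderiv ℂ F z).det ^ r = η z

/-- `A` is a nowhere dense (closed) analytic subset of the open set `U` of `ℂ³`: around every point
of `U` it is the set of common zeros of finitely many holomorphic functions, and it has empty
interior. -/
def IsThinAnalyticSubset (U A : Set C3) : Prop :=
  A ⊆ U ∧ interior A = ∅ ∧ ∀ w ∈ U, ∃ W, IsOpen W ∧ w ∈ W ∧ W ⊆ U ∧
    ∃ (n : ℕ) (f : Fin n → C3 → ℂ), (∀ i, AnalyticOnNhd ℂ (f i) W) ∧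
      A ∩ W = {z ∈ W | ∀ i, f i z = 0}

variable [TopologicalSpace X]

/-- `φ : U → X` is a (not necessarily proper) bimeromorphic morphism from the open set `U` of `ℂ³`:
it is holomorphic on `U`, and off some nowhere dense analytic subset of `U` it is injective with
values in the manifold `X°` (hence biholomorphic onto an open subset of `X`, as is every injective
holomorphic map between manifolds of the same dimension). -/
structure IsBimeromorphicMorphism (q : C3 → X) (U : Set C3) (φ : C3 → X) : Prop where
  isOpen : IsOpen U
  holomorphic : ∀ w ∈ U, HolMapAt (id : C3 → C3) q φ w
  generic : ∃ A, IsThinAnalyticSubset U A ∧ Set.InjOn φ (U \ A) ∧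
    ∀ w ∈ U \ A, φ w ∈ unramifiedLocus q

/-- The pullback along `φ : U → X` of the pluricanonical form represented by `η` extends to a
holomorphic section of `ω^r` over `U`. In terms of a holomorphic lift `F` of `φ` at a point, the
pullback is `(η ∘ F) · det (DF) ^ r · (dw₁ ∧ dw₂ ∧ dw₃) ^ r`. -/
def PullbackExtends (q : C3 → X) (r : ℕ) (η : C3 → ℂ) (U : Set C3) (φ : C3 → X) : Prop :=
  ∃ h : C3 → ℂ, AnalyticOnNhd ℂ h U ∧ ∀ w ∈ U, φ w ∈ unramifiedLocus q →
    ∀ F : C3 → C3, IsLiftAt q φ F w → h w = η (F w) * (fderiv ℂ F w).det ^ r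

/-- `X` has canonical singularities: some positive multiple of `K_X` is Cartier around every point,
and all divisors over `X` have discrepancy `≥ 0`. The latter is to say that for every bimeromorphic
morphism `φ` from a manifold to `X`, where `r K_X` is Cartier with local generator `η`, the
pullback of `η` along `φ` has no poles (`r K_Y = φ^* (r K_X) + Σ r a_E E` with all `a_E ≥ 0`). This
is local on the manifold, so that the manifold may be taken to be an open subset of `ℂ³`. -/
structure HasCanonicalSingularities (q : C3 → X) : Prop where
  qGorenstein : ∀ x : X, ∃ r : ℕ, 0 < r ∧ ∃ V : Set X, IsOpen V ∧ x ∈ V ∧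
    ∃ η : C3 → ℂ, IsPluricanonicalGenerator q r V η
  discrepancy_nonneg : ∀ (r : ℕ) (V : Set X) (η : C3 → ℂ), 0 < r → IsOpen V →
    IsPluricanonicalGenerator q r V η → ∀ (U : Set C3) (φ : C3 → X),
      IsBimeromorphicMorphism q U φ → Set.MapsTo φ U V → PullbackExtends q r η U φ

end Canonical

/-! ### Quotients of three-dimensional complex tori -/

section Torus

variable (Λ : Submodule ℤ C3)

/-- The quotient map `ℂ³ → T = ℂ³ / Λ`. -/
def torusMk : C3 → C3 ⧸ Λ := fun z => Submodule.Quotient.mk z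

variable (G : Type*) [Group G] [MulAction G (C3 ⧸ Λ)]

/-- The quotient `X = T / G` with the quotient topology. -/
abbrev TorusQuotient : Type := Quotient (MulAction.orbitRel G (C3 ⧸ Λ))

/-- The quotient map `T → X = T / G`. -/
def orbitMk : C3 ⧸ Λ → TorusQuotient Λ G :=
  fun p => Quotient.mk (MulAction.orbitRel G (C3 ⧸ Λ)) p

/-- The quotient map `ℂ³ → T → X = T / G`. -/
def torusQuotientMk : C3 → TorusQuotient Λ G := fun z => orbitMk Λ G (torusMk Λ z)

/-- The group `G` acts on `T` by holomorphic maps. -/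
def IsHolomorphicAction : Prop :=
  ∀ (g : G) (p : C3 ⧸ Λ), HolMapAt (torusMk Λ) (torusMk Λ) (fun x => g • x) p

/-- No non-trivial element of `G` acts on `T` as a translation. -/
def IsTranslationFree : Prop :=
  ∀ (g : G) (t : C3 ⧸ Λ), (∀ p : C3 ⧸ Λ, g • p = p + t) → g = 1

/-- The fixed locus of the action, i.e. the set of points with non-trivial stabilizer, is finite
(on the compact manifold `T` this means that the fixed points are isolated). -/
def HasFiniteFixedLocus : Prop :=
  {p : C3 ⧸ Λ | MulAction.stabilizer G p ≠ ⊥}.Finite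

end Torus

/-! A holomorphic self-map of `T` lifts to `ℂ³`; its derivative is periodic, hence bounded, hence
constant by Liouville. So `G` acts by affine maps with linear parts `ρ` (`exists_isAffineAction`),
and near a fixed point the quotient is `ℂ³` modulo the linear action of the stabilizer. Two facts
about this representation drive the classification. Non-trivial elements have no non-zero fixed
vector, since otherwise a whole segment of points would be fixed. The characteristic polynomial of
the underlying real representation is integral, since `ρ` preserves `Λ`. Together these form
`IsFreeIntegralRep`.

Freeness makes every eigenvalue of an element of order `n` a primitive `n`-th root of unity.
Integrality makes the eigenvalues and their conjugates together fill the primitive `n`-th roots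
uniformly, so `φ(n)` divides 6 (`IsFreeIntegralRep.spectrum`). This leaves `n` in {1, 2, 3, 4, 6, 7,
9, 14, 18}. In odd order, the vanishing of the sum of all traces becomes `3 n₃ + n₇ = 6`, where `nᵢ`
counts elements of order `i`, and cyclicity follows (`isCyclic_of_odd`). The general case is reduced
to this one by a power of the determinant (`isCyclic`). Changing the generator and permuting
coordinates then leaves fifteen diagonal types (`exists_normal_form`).

Seven of these are not canonical. For a diagonal element `(ξ, ξ ^ a, ξ ^ b)` of order `N`, the
weighted blow-up with weights `1, a, b` has the chart `(t, s₁, s₂) ↦ (τ, τ ^ a s₁, τ ^ b s₂)` with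
`τ ^ N = t`. It pulls `dx₁ ∧ dx₂ ∧ dx₃` back to a constant times `t ^ ((1 + a + b) / N - 1) dt ∧ ds₁
∧ ds₂`. A canonical singularity therefore forces `N ≤ 1 + a + b` (`IsDiagonalModel.le_one_add_add`),
which excludes all seven. The `N`-th root is only a pointwise choice, so holomorphy of the chart
along `t = 0` rests on Riemann's extension theorem (`analyticAt_of_continuous_of_analyticAt_off`),
proved by Cauchy integrals depending analytically on parameters. -/

/-! ### Analytic dependence of circle integrals on parameters -/

section ParametricIntegral

variable {E : Type*} [NormedAddCommGroup E] [NormedSpace ℂ E]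

open FormalMultilinearSeries in
/-- Power series expansions in the second variable of a jointly analytic function, uniform in the
first variable. -/
lemma AnalyticAt.exists_partial_powerSeries {f : ℂ × E → ℂ} {θ₀ : ℂ} {x₀ : E}
    (hf : AnalyticAt ℂ f (θ₀, x₀)) :
    ∃ V : Set ℂ, IsOpen V ∧ θ₀ ∈ V ∧ ∃ (c : ℂ → FormalMultilinearSeries ℂ E ℂ) (r : NNReal)
      (u : ℕ → ℝ), 0 < r ∧ Summable u ∧ (∀ n, ContinuousOn (fun θ => c θ n) V) ∧
      (∀ θ ∈ V, ∀ n, ‖c θ n‖ * r ^ n ≤ u n) ∧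
      ∀ θ ∈ V, ∀ y : E, ‖y‖ < r → HasSum (fun n => c θ n fun _ => y) (f (θ, x₀ + y)) := by
  obtain ⟨p, R, hp⟩ := hf
  -- One `r` pays for moving the centre to `θ`, the other for the radius of the recentred series;
  -- hence `r + r < R`.
  obtain ⟨r, hr0, hr⟩ : ∃ r : NNReal, 0 < r ∧ (r + r : ENNReal) < R := by
    obtain ⟨s, hs0, hs⟩ := ENNReal.lt_iff_exists_nnreal_btwn.1 hp.r_pos
    refine ⟨s / 2, by simpa using hs0, ?_⟩
    rw [← ENNReal.coe_add, add_halves]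
    exact hs
  have hrp : (r + r : ENNReal) < p.radius := hr.trans_le hp.r_le
  have hrR : (r : ENNReal) < R := lt_of_le_of_lt (by simp) hr
  have hrr : (r : ENNReal) < p.radius := hrR.trans_le hp.r_le
  have hV : ∀ θ ∈ Metric.ball θ₀ (r : ℝ), ‖((θ - θ₀, 0) : ℂ × E)‖₊ < r := by
    intro θ hθ
    rw [mem_ball_iff_norm] at hθ
    rw [← NNReal.coe_lt_coe, coe_nnnorm, Prod.norm_def]
    simp [hθ]
  let i : E →L[ℂ] ℂ × E := ContinuousLinearMap.inr ℂ ℂ E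
  have hi : ‖i‖ ≤ 1 := ContinuousLinearMap.opNorm_le_bound _ zero_le_one fun y => by
    simp [i, Prod.norm_def]
  -- The coefficients are those of `p` recentred at `(θ - θ₀, 0)` and restricted to the second
  -- factor. The majorant is independent of `θ` because `‖θ - θ₀‖` is replaced by `r`.
  refine ⟨Metric.ball θ₀ r, Metric.isOpen_ball, Metric.mem_ball_self hr0,
    fun θ => (p.changeOrigin (θ - θ₀, 0)).compContinuousLinearMap i, r,
    fun k => ((∑' s : Σ l : ℕ, { s : Finset (Fin (k + l)) // s.card = l },
      ‖p (k + s.1)‖₊ * r ^ s.1 * r ^ k : NNReal) : ℝ), hr0, ?_, ?_, ?_, ?_⟩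
  · exact NNReal.summable_coe.2 (NNReal.summable_sigma.1 (p.changeOriginSeries_summable_aux₁ hrp)).2
  · intro n θ hθ
    apply ContinuousAt.continuousWithinAt
    have h1 := (p.hasFPowerSeriesOnBall_changeOrigin n (lt_of_le_of_lt zero_le hrr)).analyticOnNhd
      ((θ - θ₀, 0) : ℂ × E) (by
        rw [mem_eball_zero_iff]
        exact lt_trans (by exact_mod_cast hV θ hθ) hrr)
    have h2 : ContinuousAt (fun θ : ℂ => p.changeOrigin ((θ - θ₀, 0) : ℂ × E) n) θ :=
      ContinuousAt.comp (f := fun θ : ℂ => ((θ - θ₀, 0) : ℂ × E))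
        (g := fun x => p.changeOrigin x n) h1.continuousAt (by fun_prop)
    exact ContinuousAt.comp (g := ContinuousMultilinearMap.compContinuousLinearMapL
      (F := ℂ) fun _ : Fin n => i) (ContinuousLinearMap.continuous _).continuousAt h2
  · intro θ hθ n
    have h1 : ‖((p.changeOrigin (θ - θ₀, 0)).compContinuousLinearMap i) n‖ ≤
        ‖p.changeOrigin (θ - θ₀, 0) n‖ := by
      refine ((p.changeOrigin (θ - θ₀, 0) n).norm_compContinuousLinearMap_le _).trans ?_
      refine mul_le_of_le_one_right (norm_nonneg _) ?_
      simpa using pow_le_one₀ (norm_nonneg _) hi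
    have h3 := hV θ hθ
    have h2 := p.nnnorm_changeOrigin_le (x := (θ - θ₀, 0)) n
      (lt_trans (by exact_mod_cast h3) hrr)
    have h4 : ‖p.changeOrigin (θ - θ₀, 0) n‖₊ * r ^ n ≤
        ∑' s : Σ l : ℕ, { s : Finset (Fin (n + l)) // s.card = l },
          ‖p (n + s.1)‖₊ * r ^ s.1 * r ^ n := by
      rw [NNReal.tsum_mul_right]
      gcongr
      refine h2.trans ?_
      have h5 := p.changeOriginSeries_summable_aux₂ hrr n
      refine Summable.tsum_le_tsum (fun s => ?_) (NNReal.summable_of_le (fun s => ?_) h5) h5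
      all_goals gcongr
    calc _ ≤ ‖p.changeOrigin (θ - θ₀, 0) n‖ * r ^ n := by gcongr
      _ ≤ _ := by exact_mod_cast h4
  · intro θ hθ y hy
    have h3 : (‖((θ - θ₀, 0) : ℂ × E)‖₊ : ENNReal) < r := by exact_mod_cast hV θ hθ
    have h1 := hp.changeOrigin (h3.trans hrR)
    have h2 := h1.hasSum (y := ((0, y) : ℂ × E)) (by
      rw [mem_eball_zero_iff, lt_tsub_iff_right]
      refine lt_of_le_of_lt ?_ hr
      gcongr
      · have : ‖((0, y) : ℂ × E)‖ₑ = ‖y‖ₑ := by 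
          rw [← ofReal_norm, ← ofReal_norm, Prod.norm_def]
          simp
        rw [this, ← ofReal_norm, ← ENNReal.ofReal_coe_nnreal]
        exact ENNReal.ofReal_le_ofReal hy.le)
    have h4 : ((θ₀, x₀) : ℂ × E) + (θ - θ₀, 0) + (0, y) = (θ, x₀ + y) := by simp
    rw [h4] at h2
    simpa [FormalMultilinearSeries.compContinuousLinearMap, i, Function.comp_def] using h2

open MeasureTheory

/-- The bound `u` is uniform in `θ` and summable, so the series may be integrated term by term by
dominated convergence. Integrability is part of the conclusion because it is needed to add integrals
over several pieces. -/
lemma analyticAt_setIntegral_of_partial_powerSeries {S : Set ℝ} (hS : MeasurableSet S)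
    (hSfin : volume S ≠ ⊤) {F : ℝ → E → ℂ} {x₀ : E} (c : ℝ → FormalMultilinearSeries ℂ E ℂ)
    {r : NNReal} {u : ℕ → ℝ} (hr : 0 < r) (hu : Summable u)
    (hc : ∀ n, ContinuousOn (fun θ => c θ n) S) (hb : ∀ θ ∈ S, ∀ n, ‖c θ n‖ * r ^ n ≤ u n)
    (hsum : ∀ θ ∈ S, ∀ y : E, ‖y‖ < r → HasSum (fun n => c θ n fun _ => y) (F θ (x₀ + y))) :
    (∀ᶠ x in 𝓝 x₀, IntegrableOn (fun θ => F θ x) S) ∧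
      AnalyticAt ℂ (fun x => ∫ θ in S, F θ x) x₀ := by
  have : IsFiniteMeasure (volume.restrict S) := ⟨by simpa using hSfin.lt_top⟩
  have hr' : (0 : ℝ) < r := hr
  have hcm : ∀ n, AEStronglyMeasurable (fun θ => c θ n) (volume.restrict S) := fun n =>
    (hc n).aestronglyMeasurable hS
  have hcb : ∀ θ ∈ S, ∀ n, ‖c θ n‖ ≤ u n / r ^ n := fun θ hθ n =>
    (le_div_iff₀ (by positivity)).2 (hb θ hθ n)
  have hci : ∀ n, Integrable (fun θ => c θ n) (volume.restrict S) := fun n =>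
    Integrable.of_bound (hcm n) (u n / r ^ n)
      ((ae_restrict_iff' hS).2 (Eventually.of_forall fun θ hθ => hcb θ hθ n))
  have key : ∀ y : E, ‖y‖ < r → Integrable (fun θ => F θ (x₀ + y)) (volume.restrict S) ∧
      HasSum (fun n => (∫ θ in S, c θ n) fun _ => y) (∫ θ in S, F θ (x₀ + y)) := by
    intro y hy
    have hyb : ∀ θ ∈ S, ∀ n, ‖c θ n fun _ => y‖ ≤ u n := fun θ hθ n => by
      refine ((c θ n).le_opNorm _).trans (le_trans ?_ (hb θ hθ n))
      simp only [Finset.prod_const, Finset.card_univ, Fintype.card_fin]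
      gcongr
    have hi : ∀ n, Integrable (fun θ => c θ n fun _ => y) (volume.restrict S) := fun n =>
      (ContinuousMultilinearMap.apply ℂ (fun _ : Fin n => E) ℂ fun _ => y).integrable_comp (hci n)
    have hu0 : ∀ θ ∈ S, ∀ n, 0 ≤ u n := fun θ hθ n => (norm_nonneg _).trans (hyb θ hθ n)
    have hF : ∀ᵐ θ ∂(volume.restrict S), HasSum (fun n => c θ n fun _ => y) (F θ (x₀ + y)) :=
      (ae_restrict_iff' hS).2 (Eventually.of_forall fun θ hθ => hsum θ hθ y hy)
    refine ⟨?_, ?_⟩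
    · refine Integrable.of_bound (C := ∑' n, u n) ?_ ?_
      · refine aestronglyMeasurable_of_tendsto_ae atTop
          (f := fun k θ => ∑ n ∈ Finset.range k, c θ n fun _ => y) (fun k => ?_) ?_
        · exact (integrable_finsetSum _ fun n _ => hi n).1
        · filter_upwards [hF] with θ hθ using hθ.tendsto_sum_nat
      · refine (ae_restrict_iff' hS).2 (Eventually.of_forall fun θ hθ => ?_)
        rw [← (hsum θ hθ y hy).tsum_eq]
        exact tsum_of_norm_bounded hu.hasSum (hyb θ hθ)
    · have h := hasSum_integral_of_dominated_convergence (μ := volume.restrict S)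
        (F := fun n θ => c θ n fun _ => y) (f := fun θ => F θ (x₀ + y)) (fun n _ => u n)
        (fun n => (hi n).1)
        (fun n => (ae_restrict_iff' hS).2 (Eventually.of_forall fun θ hθ => hyb θ hθ n))
        (Eventually.of_forall fun _ => hu) (integrable_const _) hF
      refine h.congr_fun ?_
      exact fun n => ContinuousMultilinearMap.integral_apply (hci n) _
  refine ⟨?_, fun n => ∫ θ in S, c θ n, r, ?_, by exact_mod_cast hr, ?_⟩
  · filter_upwards [Metric.ball_mem_nhds x₀ hr'] with x hx
    rw [mem_ball_iff_norm] at hx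
    have := (key (x - x₀) hx).1
    rwa [add_sub_cancel] at this
  · have hub : ∀ n, ‖∫ θ in S, c θ n‖ * r ^ n ≤ |u n| * volume.real S := by
      intro n
      have h1 : ‖∫ θ in S, c θ n‖ ≤ |u n| / r ^ n * volume.real S :=
        norm_setIntegral_le_of_norm_le_const hSfin.lt_top fun θ hθ =>
          (hcb θ hθ n).trans (by gcongr; exact le_abs_self _)
      calc _ ≤ |u n| / r ^ n * volume.real S * r ^ n := by gcongr
        _ = _ := by field_simp
    refine FormalMultilinearSeries.le_radius_of_summable_norm _ ?_
    exact Summable.of_nonneg_of_le (fun n => by positivity) hub (hu.abs.mul_right _)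
  · intro y hy
    refine (key y ?_).2
    rw [mem_eball_zero_iff] at hy
    have : ‖y‖ₑ = (‖y‖₊ : ENNReal) := rfl
    rw [this, ENNReal.coe_lt_coe] at hy
    exact_mod_cast hy

/-- Uniform expansions exist near each parameter value, and compactness of `S` reduces to finitely
many pieces. -/
lemma analyticAt_setIntegral {S : Set ℝ} (hS : IsCompact S) {γ w : ℝ → ℂ} (hγ : Continuous γ)
    (hw : Continuous w) {f : ℂ × E → ℂ} {x₀ : E} (hf : ∀ t ∈ S, AnalyticAt ℂ f (γ t, x₀)) :
    AnalyticAt ℂ (fun x => ∫ t in S, w t * f (γ t, x)) x₀ := by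
  -- The claim is made for all measurable subsets of `s'`, so that a union of two pieces can be cut
  -- into disjoint parts.
  have key : ∃ s', MeasurableSet s' ∧ S ⊆ s' ∧ ∀ t ⊆ s', MeasurableSet t →
      (∀ᶠ x in 𝓝 x₀, IntegrableOn (fun θ => w θ * f (γ θ, x)) t) ∧
        AnalyticAt ℂ (fun x => ∫ θ in t, w θ * f (γ θ, x)) x₀ := by
    refine hS.induction_on ?_ ?_ ?_ ?_
    · exact ⟨∅, MeasurableSet.empty, subset_rfl, fun t ht _ => by
        rw [Set.subset_empty_iff.1 ht]
        simpa using analyticAt_const⟩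
    · rintro s t hst ⟨s', h1, h2, h3⟩
      exact ⟨s', h1, hst.trans h2, h3⟩
    · rintro s t ⟨s', h1, h2, h3⟩ ⟨t', k1, k2, k3⟩
      refine ⟨s' ∪ t', h1.union k1, Set.union_subset_union h2 k2, fun v hv hvm => ?_⟩
      obtain ⟨hi1, ha1⟩ := h3 (v ∩ s') Set.inter_subset_right (hvm.inter h1)
      obtain ⟨hi2, ha2⟩ := k3 (v \ s') (fun x hx => (hv hx.1).resolve_left hx.2) (hvm.diff h1)
      have hv' : v ∩ s' ∪ v \ s' = v := Set.inter_union_sdiff v s'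
      refine ⟨?_, ?_⟩
      · filter_upwards [hi1, hi2] with x hx1 hx2
        rw [← hv']
        exact hx1.union hx2
      · refine (ha1.add ha2).congr ?_
        filter_upwards [hi1, hi2] with x hx1 hx2
        simp only [Pi.add_apply]
        conv_rhs => rw [← hv']
        rw [setIntegral_union Set.disjoint_sdiff_inter.symm (hvm.diff h1) hx1 hx2]
    · intro t₀ ht₀
      obtain ⟨V, hVo, hV, c, r, u, hr, hu, hc, hb, hs⟩ := (hf t₀ ht₀).exists_partial_powerSeries
      -- The second factor bounds the weight `w`, and the unit ball guarantees finite measure.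
      let s' : Set ℝ := γ ⁻¹' V ∩ ({t | ‖w t‖ < ‖w t₀‖ + 1} ∩ Metric.ball t₀ 1)
      have hs'o : IsOpen s' := (hVo.preimage hγ).inter
        ((isOpen_lt (by fun_prop) continuous_const).inter Metric.isOpen_ball)
      have ht₀s : t₀ ∈ s' := ⟨hV, by simp, by simp⟩
      refine ⟨s', mem_nhdsWithin_of_mem_nhds (hs'o.mem_nhds ht₀s), s', hs'o.measurableSet,
        subset_rfl, fun t ht htm => ?_⟩
      refine analyticAt_setIntegral_of_partial_powerSeries htm ?_ (fun θ n => w θ • c (γ θ) n)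
        (u := fun n => (‖w t₀‖ + 1) * u n) hr (hu.mul_left _) (fun n => ?_) (fun θ hθ n => ?_)
        (fun θ hθ y hy => ?_)
      · refine ne_top_of_le_ne_top ?_ (measure_mono (ht.trans fun x hx => hx.2.2))
        exact measure_ball_lt_top.ne
      · exact hw.continuousOn.smul ((hc n).comp hγ.continuousOn fun x hx => (ht hx).1)
      · rw [norm_smul, mul_assoc]
        exact mul_le_mul (ht hθ).2.1.le (hb _ (ht hθ).1 n) (by positivity) (by positivity)
      · exact (hs _ (ht hθ).1 y hy).mul_left (w θ)
  obtain ⟨s', -, h2, h3⟩ := key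
  exact (h3 S h2 hS.measurableSet).2

/-- Circle integrals depend analytically on parameters. -/
lemma analyticAt_circleIntegral {a : ℂ} {R : ℝ} (hR : 0 ≤ R) {f : ℂ × E → ℂ} {x₀ : E}
    (hf : ∀ θ ∈ Metric.sphere a R, AnalyticAt ℂ f (θ, x₀)) :
    AnalyticAt ℂ (fun x => ∮ θ in C(a, R), f (θ, x)) x₀ := by
  simp_rw [circleIntegral_def_Icc, smul_eq_mul]
  refine analyticAt_setIntegral isCompact_Icc (continuous_circleMap a R) ?_ fun t _ =>
    hf _ (circleMap_mem_sphere a hR t)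
  rw [show deriv (circleMap a R) = fun t => circleMap 0 R t * Complex.I from
    funext fun t => deriv_circleMap a R t]
  fun_prop

/-- A version of Riemann's extension theorem in several variables: a continuous function which is
analytic off the hyperplane `t = 0` is analytic. -/
lemma analyticAt_of_continuous_of_analyticAt_off {K : ℂ × E → ℂ} {s₀ : E}
    (hc : ∀ᶠ p in 𝓝 ((0, s₀) : ℂ × E), ContinuousAt K p)
    (ha : ∀ᶠ p in 𝓝 ((0, s₀) : ℂ × E), p.1 ≠ 0 → AnalyticAt ℂ K p) :
    AnalyticAt ℂ K (0, s₀) := by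
  obtain ⟨ε, hε, h⟩ := Metric.eventually_nhds_iff_ball.1 (hc.and ha)
  let R := ε / 2
  have hR : 0 < R := by positivity
  have hmem : ∀ t s, ‖t‖ < ε → ‖s - s₀‖ < ε → ((t, s) : ℂ × E) ∈ Metric.ball (0, s₀) ε := by
    intro t s ht hs
    rw [mem_ball_iff_norm, Prod.norm_def]
    simpa using ⟨ht, hs⟩
  -- The Cauchy integral in the first variable only sees `K` on `‖θ‖ = R`, away from the hyperplane,
  -- so it is analytic in both variables. It equals `K` because the one-variable formula allows the
  -- exceptional point 0, where `K` is merely continuous.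
  have hA : AnalyticAt ℂ (fun x : ℂ × E =>
      (2 * Real.pi * Complex.I : ℂ)⁻¹ * ∮ θ in C(0, R), (θ - x.1)⁻¹ * K (θ, x.2)) (0, s₀) := by
    refine analyticAt_const.mul
      (analyticAt_circleIntegral (f := fun y : ℂ × (ℂ × E) => (y.1 - y.2.1)⁻¹ * K (y.1, y.2.2))
        hR.le fun θ hθ => ?_)
    have hθ' : ‖θ‖ = R := by simpa using hθ
    have hθ0 : θ ≠ 0 := by rw [← norm_pos_iff, hθ']; exact hR
    refine AnalyticAt.mul (AnalyticAt.inv (analyticAt_fst.sub (analyticAt_fst.comp analyticAt_snd))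
      (by simpa using hθ0)) ?_
    have h1 : AnalyticAt ℂ K (θ, s₀) :=
      (h _ (hmem θ s₀ (by rw [hθ']; exact half_lt_self hε) (by simpa using hε))).2 hθ0
    exact AnalyticAt.fun_comp (g := K) (f := fun y : ℂ × (ℂ × E) => (y.1, y.2.2)) h1
      (analyticAt_fst.prod (analyticAt_snd.comp analyticAt_snd))
  refine hA.congr ?_
  filter_upwards [Metric.ball_mem_nhds ((0, s₀) : ℂ × E) hR] with x hx
  rw [mem_ball_iff_norm, Prod.norm_def] at hx
  obtain ⟨hx1, hx2⟩ : ‖x.1‖ < R ∧ ‖x.2 - s₀‖ < R := by simpa using hx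
  have hRε : R < ε := half_lt_self hε
  have := Complex.two_pi_I_inv_smul_circleIntegral_sub_inv_smul_of_differentiable_on_off_countable
    (R := R) (c := 0) (w := x.1) (f := fun θ => K (θ, x.2)) (s := {0}) (Set.countable_singleton 0)
    (by simpa using hx1) (fun θ hθ => ?_) (fun θ hθ => ?_)
  · simpa using this
  · have h1 := (h _ (hmem θ x.2 (lt_of_le_of_lt (by simpa using hθ) hRε) (hx2.trans hRε))).1
    exact (ContinuousAt.comp (g := K) (f := fun θ => (θ, x.2)) h1
      (by fun_prop)).continuousWithinAt
  · have h1 := (h _ (hmem θ x.2 (lt_trans (by simpa using hθ.1) hRε) (hx2.trans hRε))).2 hθ.2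
    exact (AnalyticAt.fun_comp (g := K) (f := fun θ => (θ, x.2)) h1
      (by fun_prop)).differentiableAt

end ParametricIntegral

/-! ### Integral polynomials whose roots are primitive roots of unity -/

section Cyclotomic

open Polynomial

/-- `cyclotomic n ℤ` is the minimal polynomial of any root of `P`, so it divides `P`; the quotient
satisfies the same hypotheses in lower degree. -/
lemma exists_eq_cyclotomic_pow {n : ℕ} (hn : 0 < n) (P : ℤ[X]) (hP : P.Monic)
    (hroots : ∀ z : ℂ, aeval z P = 0 → IsPrimitiveRoot z n) :
    ∃ k : ℕ, P = cyclotomic n ℤ ^ k := by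
  induction hd : P.natDegree using Nat.strong_induction_on generalizing P with
  | _ d ih =>
    rcases Nat.eq_zero_or_pos d with h0 | h0
    · exact ⟨0, by rw [pow_zero]; exact hP.natDegree_eq_zero.1 (hd.trans h0)⟩
    · obtain ⟨z, hz⟩ := IsAlgClosed.exists_aeval_eq_zero ℂ P (by
        rw [degree_eq_natDegree hP.ne_zero, hd]
        exact_mod_cast h0.ne')
      have hzn := hroots z hz
      have hdvd : cyclotomic n ℤ ∣ P := by
        rw [cyclotomic_eq_minpoly hzn hn]
        exact minpoly.isIntegrallyClosed_dvd (hzn.isIntegral hn) hz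
      obtain ⟨Q, rfl⟩ := hdvd
      have hQ : Q.Monic := (cyclotomic.monic n ℤ).of_mul_monic_left hP
      have hdeg : Q.natDegree < d := by
        rw [← hd, (cyclotomic.monic n ℤ).natDegree_mul hQ, natDegree_cyclotomic]
        exact Nat.lt_add_of_pos_left (Nat.totient_pos.2 hn)
      obtain ⟨k, rfl⟩ := ih _ hdeg Q hQ (fun w hw => hroots w (by rw [map_mul, hw, mul_zero])) rfl
      exact ⟨k + 1, by rw [pow_succ']⟩

/-- The prime powers whose totient divides 6 are 2, 4, 3, 9, 7, and 252 = 4 · 9 · 7. -/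
lemma dvd_252_of_totient_dvd_six {n : ℕ} (h : n.totient ∣ 6) : n ∣ 252 := by
  refine (Nat.dvd_iff_prime_pow_dvd_dvd _ _).2 fun p k hp hk => ?_
  rcases Nat.eq_zero_or_pos k with rfl | hk0
  · simp
  have h1 : p ^ (k - 1) * (p - 1) ∣ 6 := by
    rw [← Nat.totient_prime_pow hp hk0]
    exact (Nat.totient_dvd_of_dvd hk).trans h
  have hp1 : p - 1 ∣ 6 := (Dvd.intro_left _ rfl).trans h1
  have hp7 : p ≤ 7 := by have := Nat.le_of_dvd (by norm_num) hp1; omega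
  have hp2 := hp.two_le
  have hpk : p ^ (k - 1) ∣ 6 := (Dvd.intro _ rfl).trans h1
  have hk3 : k - 1 ≤ 2 := by
    by_contra hcon
    have h2 : 2 ^ 3 ≤ p ^ (k - 1) := (Nat.pow_le_pow_left hp2 3).trans
      (Nat.pow_le_pow_right (by omega) (by omega))
    have := Nat.le_of_dvd (by norm_num) hpk
    omega
  obtain ⟨j, rfl⟩ : ∃ j, k = j + 1 := ⟨k - 1, by omega⟩
  simp only [Nat.add_sub_cancel] at *
  interval_cases p <;> interval_cases j <;> revert h1 hp <;> decide

lemma mem_orders_of_totient_dvd_six {n : ℕ} (h : n.totient ∣ 6) :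
    n ∈ ({1, 2, 3, 4, 6, 7, 9, 14, 18} : Finset ℕ) := by
  have h1 : n ∈ Nat.divisors 252 := Nat.mem_divisors.2 ⟨dvd_252_of_totient_dvd_six h, by norm_num⟩
  have h2 : ∀ m ∈ Nat.divisors 252, m.totient ∣ 6 →
      m ∈ ({1, 2, 3, 4, 6, 7, 9, 14, 18} : Finset ℕ) := by decide +kernel
  exact h2 n h1 h

lemma sum_primitiveRoots_eq_neg_coeff {n : ℕ} (hn : 0 < n) :
    ∑ z ∈ primitiveRoots n ℂ, z = -((cyclotomic n ℤ).coeff (n.totient - 1) : ℂ) := by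
  have hdeg : (cyclotomic n ℂ).natDegree = n.totient := natDegree_cyclotomic n ℂ
  have h := (IsAlgClosed.splits (cyclotomic n ℂ)).nextCoeff_eq_neg_sum_roots_of_monic
    (cyclotomic.monic n ℂ)
  have : NeZero (n : ℂ) := ⟨by exact_mod_cast hn.ne'⟩
  rw [cyclotomic.roots_eq_primitiveRoots_val, nextCoeff, hdeg,
    if_neg (Nat.totient_pos.2 hn).ne', ← map_cyclotomic_int, coeff_map] at h
  rw [Finset.sum_eq_multiset_sum, Multiset.map_id']
  simp only [eq_intCast] at h
  rw [h, neg_neg]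

lemma sum_primitiveRoots_prime {p : ℕ} [hp : Fact p.Prime] :
    ∑ z ∈ primitiveRoots p ℂ, z = -1 := by
  rw [sum_primitiveRoots_eq_neg_coeff hp.out.pos, cyclotomic_prime, Nat.totient_prime hp.out,
    finsetSum_coeff]
  simp only [coeff_X_pow]
  rw [Finset.sum_ite_eq, if_pos]
  · simp
  · have := hp.out.two_le
    simp only [Finset.mem_range]
    omega

lemma sum_primitiveRoots_nine : ∑ z ∈ primitiveRoots 9 ℂ, z = 0 := by
  have : Fact (Nat.Prime 3) := ⟨Nat.prime_three⟩
  have h9 : cyclotomic 9 ℤ = ∑ i ∈ Finset.range 3, (X ^ 3 ^ 1) ^ i :=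
    cyclotomic_prime_pow_eq_geom_sum (n := 1) (p := 3) (R := ℤ) Nat.prime_three
  have ht : Nat.totient 9 = 6 := by decide +kernel
  rw [sum_primitiveRoots_eq_neg_coeff (by norm_num), h9, ht]
  simp [Finset.sum_range_succ, ← pow_mul, coeff_X_pow, coeff_one]

end Cyclotomic

/-! ### Diagonalization -/

section Diagonalization

/-- `X ^ n - 1` is squarefree and annihilates `f`, so `f` is semisimple and the space is the direct
sum of the eigenspaces. -/
lemma Module.End.exists_eigenbasis_of_pow_eq_one {V : Type*} [AddCommGroup V] [Module ℂ V]
    {m : ℕ} (b₀ : Module.Basis (Fin m) ℂ V) {f : Module.End ℂ V} {n : ℕ} (hn : n ≠ 0)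
    (hf : f ^ n = 1) :
    ∃ (b : Module.Basis (Fin m) ℂ V) (μ : Fin m → ℂ), ∀ i, f (b i) = μ i • b i := by
  classical
  have : FiniteDimensional ℂ V := Module.Finite.of_basis b₀
  have hss : f.IsSemisimple := by
    refine Module.End.isSemisimple_of_squarefree_aeval_eq_zero
      (p := (Polynomial.X ^ n - 1 : Polynomial ℂ)) ?_ (by simp [hf])
    exact (Polynomial.separable_X_pow_sub_C (1 : ℂ) (by exact_mod_cast hn) one_ne_zero).squarefree
  have h := DirectSum.isInternal_submodule_of_iSupIndep_of_iSup_eq_top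
    f.eigenspaces_iSupIndep hss.iSup_eigenspace_eq_top
  let v := h.collectedBasis fun μ => Module.finBasis ℂ (f.eigenspace μ)
  let e := v.indexEquiv b₀
  refine ⟨v.reindex e, fun i => (e.symm i).1, fun i => ?_⟩
  rw [Module.Basis.reindex_apply]
  exact Module.End.mem_eigenspace_iff.1 (h.collectedBasis_mem _ (e.symm i))

variable {V : Type*} [AddCommGroup V] [Module ℂ V] {ι : Type*} [Fintype ι] [DecidableEq ι]
  {b : Module.Basis ι ℂ V} {μ : ι → ℂ} {f : Module.End ℂ V}

lemma toMatrix_eq_diagonal (h : ∀ i, f (b i) = μ i • b i) :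
    LinearMap.toMatrix b b f = Matrix.diagonal μ := by
  ext i j
  rw [LinearMap.toMatrix_apply, h j, map_smul, Module.Basis.repr_self, Finsupp.smul_apply,
    Finsupp.single_apply, Matrix.diagonal_apply]
  by_cases hij : i = j
  · simp [hij]
  · simp [hij, Ne.symm hij]

lemma trace_eq_sum_of_eigenbasis (h : ∀ i, f (b i) = μ i • b i) :
    LinearMap.trace ℂ V f = ∑ i, μ i := by
  rw [LinearMap.trace_eq_matrix_trace ℂ b, toMatrix_eq_diagonal h, Matrix.trace_diagonal]

lemma det_eq_prod_of_eigenbasis (h : ∀ i, f (b i) = μ i • b i) :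
    LinearMap.det f = ∏ i, μ i := by
  rw [← LinearMap.det_toMatrix b, toMatrix_eq_diagonal h, Matrix.det_diagonal]

open Polynomial in
lemma charpoly_eq_prod_of_eigenbasis [Module.Finite ℂ V] (h : ∀ i, f (b i) = μ i • b i) :
    f.charpoly = ∏ i, (X - C (μ i)) := by
  rw [← LinearMap.charpoly_toMatrix f b, toMatrix_eq_diagonal h, Matrix.charpoly_diagonal]

lemma exists_eq_of_eigenvector (h : ∀ i, f (b i) = μ i • b i) {v : V} (hv : v ≠ 0) {a : ℂ}
    (hva : f v = a • v) : ∃ i, μ i = a := by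
  by_contra hcon
  push Not at hcon
  refine hv (b.ext_elem fun i => ?_)
  have h1 : b.repr (f v) i = μ i * b.repr v i := by
    rw [← LinearMap.toMatrix_mulVec_repr b b f v, toMatrix_eq_diagonal h, Matrix.mulVec_diagonal]
  rw [hva, map_smul, Finsupp.smul_apply, smul_eq_mul] at h1
  have h2 : (a - μ i) * b.repr v i = 0 := by rw [sub_mul, h1, sub_self]
  simpa [sub_eq_zero, (hcon i).symm] using h2

end Diagonalization

/-! ### Free integral representations of finite groups -/

/-- A representation on `ℂ³` such that non-trivial elements have no non-zero fixed vectors, and such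
that the characteristic polynomials of the underlying real representation are integral. -/
structure IsFreeIntegralRep {H : Type*} [Group H] (ρ : H →* Module.End ℂ C3) : Prop where
  free : ∀ h : H, h ≠ 1 → ∀ v, ρ h v = v → v = 0
  integral : ∀ h : H, ∃ P : Polynomial ℤ, P.map (Int.castRingHom ℂ) =
    (ρ h).charpoly * (ρ h).charpoly.map (starRingEnd ℂ)

namespace IsFreeIntegralRep

variable {H : Type*} [Group H] {ρ : H →* Module.End ℂ C3}

lemma pow_apply {h : H} {v : C3} {a : ℂ} (hv : ρ h v = a • v) (m : ℕ) :
    ρ (h ^ m) v = a ^ m • v := by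
  induction m with
  | zero => simp
  | succ m ih => rw [pow_succ', map_mul, Module.End.mul_apply, ih, map_smul, hv, smul_smul, pow_succ]

variable (hρ : IsFreeIntegralRep ρ)
include hρ

lemma comp {H' : Type*} [Group H'] (j : H' →* H) (hj : Function.Injective j) :
    IsFreeIntegralRep (ρ.comp j) where
  free h hh := hρ.free (j h) fun hcon => hh (hj (hcon.trans (map_one j).symm))
  integral h := hρ.integral (j h)

lemma injective : Function.Injective ρ := by
  rw [injective_iff_map_eq_one]
  intro h hh
  by_contra hne
  have := hρ.free h hne 1 (by rw [hh]; rfl)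
  exact one_ne_zero this

open Polynomial in
/-- The eigenvalues of an element of order `n`, together with their conjugates, are all primitive
`n`-th roots of unity, with the same multiplicity. -/
lemma spectrum [Finite H] (h : H) :
    ∃ (b : Module.Basis (Fin 3) ℂ C3) (μ : Fin 3 → ℂ), (∀ i, ρ h (b i) = μ i • b i) ∧
      (∀ i, IsPrimitiveRoot (μ i) (orderOf h)) ∧ ∃ k, k * (orderOf h).totient = 6 ∧
        Finset.univ.val.map μ + Finset.univ.val.map (fun i => (μ i)⁻¹) =
          k • (primitiveRoots (orderOf h) ℂ).val := by
  have hn : 0 < orderOf h := orderOf_pos h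
  obtain ⟨b, μ, hb⟩ := Module.End.exists_eigenbasis_of_pow_eq_one (Pi.basisFun ℂ (Fin 3))
    (f := ρ h) hn.ne' (by rw [← map_pow, pow_orderOf_eq_one, map_one])
  -- If `μ i ^ l = 1` with `0 < l < orderOf h`, then the non-trivial element `h ^ l` would fix `b
  -- i`.
  have hprim : ∀ i, IsPrimitiveRoot (μ i) (orderOf h) := by
    intro i
    have h1 := fun m => pow_apply (hb i) m
    refine IsPrimitiveRoot.mk_of_lt _ hn ?_ fun l hl0 hl hcon => ?_
    · have h2 := h1 (orderOf h)
      rw [pow_orderOf_eq_one, map_one, Module.End.one_apply] at h2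
      exact (smul_left_injective ℂ (b.ne_zero i) (by simpa using h2)).symm
    · have h2 := h1 l
      rw [hcon, one_smul] at h2
      exact b.ne_zero i (hρ.free _ (pow_ne_one_of_lt_orderOf hl0.ne' hl) _ h2)
  refine ⟨b, μ, hb, hprim, ?_⟩
  obtain ⟨P, hP⟩ := hρ.integral h
  have hconj : ∀ i, starRingEnd ℂ (μ i) = (μ i)⁻¹ := fun i =>
    (Complex.inv_eq_conj ((hprim i).norm'_eq_one hn.ne')).symm
  have hchar : P.map (Int.castRingHom ℂ) = (∏ i, (X - C (μ i))) * ∏ i, (X - C (μ i)⁻¹) := by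
    rw [hP, charpoly_eq_prod_of_eigenbasis hb, Polynomial.map_prod]
    simp only [Polynomial.map_sub, map_X, map_C, hconj]
  have hmonic : P.Monic := by
    refine (Function.Injective.monic_map_iff (f := Int.castRingHom ℂ) Int.cast_injective).2 ?_
    rw [hchar]
    exact (monic_prod_of_monic _ _ fun i _ => monic_X_sub_C _).mul
      (monic_prod_of_monic _ _ fun i _ => monic_X_sub_C _)
  have hne : (∏ i, (X - C (μ i))) * ∏ i, (X - C (μ i)⁻¹) ≠ 0 := by
    rw [← hchar]
    exact (hmonic.map _).ne_zero
  have hroots : (P.map (Int.castRingHom ℂ)).roots =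
      Finset.univ.val.map μ + Finset.univ.val.map (fun i => (μ i)⁻¹) := by
    rw [hchar, roots_mul hne]
    congr 1
    · exact roots_multiset_prod_X_sub_C (Finset.univ.val.map μ) ▸ by
        rw [Multiset.map_map]; rfl
    · exact roots_multiset_prod_X_sub_C (Finset.univ.val.map fun i => (μ i)⁻¹) ▸ by
        rw [Multiset.map_map]; rfl
  -- All roots of the integral polynomial are primitive, so it is a power of one cyclotomic
  -- polynomial. Comparing root multisets gives the uniform multiplicity, and counting them gives `k
  -- * φ(n) = 6`.
  obtain ⟨k, hk⟩ := exists_eq_cyclotomic_pow hn P hmonic (fun z hz => by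
    have : z ∈ (P.map (Int.castRingHom ℂ)).roots := by
      rw [mem_roots (hmonic.map _).ne_zero, IsRoot.def, eval_map]
      exact hz
    rw [hroots] at this
    simp only [Multiset.mem_add, Multiset.mem_map] at this
    obtain ⟨i, -, rfl⟩ | ⟨i, -, rfl⟩ := this
    · exact hprim i
    · exact (hprim i).inv)
  have : NeZero (orderOf h : ℂ) := ⟨by exact_mod_cast hn.ne'⟩
  have hkr : (P.map (Int.castRingHom ℂ)).roots = k • (primitiveRoots (orderOf h) ℂ).val := by
    rw [hk, Polynomial.map_pow, map_cyclotomic, roots_pow, cyclotomic.roots_eq_primitiveRoots_val]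
  refine ⟨k, ?_, by rw [← hroots, hkr]⟩
  have hcard := congrArg Multiset.card (hroots.symm.trans hkr)
  simpa [Complex.card_primitiveRoots, eq_comm] using hcard

lemma orderOf_mem [Finite H] (h : H) :
    orderOf h ∈ ({1, 2, 3, 4, 6, 7, 9, 14, 18} : Finset ℕ) := by
  obtain ⟨-, -, -, -, k, hk, -⟩ := hρ.spectrum h
  exact mem_orders_of_totient_dvd_six (Dvd.intro_left k hk)

/-- Eigenvalues lie on the unit circle, so conjugates are inverses and it suffices to sum the
multiset identity of `spectrum`. -/
lemma trace_add_conj [Finite H] (h : H) {k : ℕ} (hk : k * (orderOf h).totient = 6) :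
    LinearMap.trace ℂ C3 (ρ h) + starRingEnd ℂ (LinearMap.trace ℂ C3 (ρ h)) =
      k * ∑ z ∈ primitiveRoots (orderOf h) ℂ, z := by
  obtain ⟨b, μ, hb, hprim, k', hk', hμ⟩ := hρ.spectrum h
  obtain rfl : k = k' := Nat.eq_of_mul_eq_mul_right (Nat.totient_pos.2 (orderOf_pos h))
    (hk.trans hk'.symm)
  have hsum := congrArg Multiset.sum hμ
  rw [Multiset.sum_add, Multiset.sum_nsmul, nsmul_eq_mul] at hsum
  rw [trace_eq_sum_of_eigenbasis hb, map_sum, Finset.sum_eq_multiset_sum _ fun z => z]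
  simp only [Multiset.map_id']
  rw [← hsum]
  congr 1
  refine Finset.sum_congr rfl fun i _ => ?_
  exact (Complex.inv_eq_conj ((hprim i).norm'_eq_one (orderOf_pos h).ne')).symm

lemma two_re_trace_three [Finite H] {h : H} (ho : orderOf h = 3) :
    2 * (LinearMap.trace ℂ C3 (ρ h)).re = -3 := by
  have h1 := hρ.trace_add_conj h (k := 3) (by rw [ho]; decide +kernel)
  have : Fact (Nat.Prime 3) := ⟨Nat.prime_three⟩
  rw [Complex.add_conj, ho, sum_primitiveRoots_prime] at h1
  exact_mod_cast h1.trans (by norm_num : ((3 : ℕ) : ℂ) * -1 = ((-3 : ℝ) : ℂ))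

lemma two_re_trace_seven [Finite H] {h : H} (ho : orderOf h = 7) :
    2 * (LinearMap.trace ℂ C3 (ρ h)).re = -1 := by
  have h1 := hρ.trace_add_conj h (k := 1) (by rw [ho]; decide +kernel)
  have : Fact (Nat.Prime 7) := ⟨by norm_num⟩
  rw [Complex.add_conj, ho, sum_primitiveRoots_prime] at h1
  exact_mod_cast h1.trans (by norm_num : ((1 : ℕ) : ℂ) * -1 = ((-1 : ℝ) : ℂ))

lemma two_re_trace_nine [Finite H] {h : H} (ho : orderOf h = 9) :
    2 * (LinearMap.trace ℂ C3 (ρ h)).re = 0 := by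
  have h1 := hρ.trace_add_conj h (k := 1) (by rw [ho]; decide +kernel)
  rw [Complex.add_conj, ho, sum_primitiveRoots_nine] at h1
  exact_mod_cast h1.trans (by norm_num : ((1 : ℕ) : ℂ) * 0 = ((0 : ℝ) : ℂ))

/-- The vector `ρ t v + v` is fixed by `t`, hence zero. In particular an involution is unique and
central. -/
lemma apply_eq_neg_one_of_orderOf_two {t : H} (ht : orderOf t = 2) : ρ t = -1 := by
  have ht2 : ρ t * ρ t = 1 := by rw [← map_mul, ← sq, ← ht, pow_orderOf_eq_one, map_one]
  have hne : t ≠ 1 := fun h => by simp [h] at ht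
  refine LinearMap.ext fun v => ?_
  have h1 : ρ t (ρ t v + v) = ρ t v + v := by
    rw [map_add, ← Module.End.mul_apply, ht2, Module.End.one_apply, add_comm]
  exact eq_neg_of_add_eq_zero_left (hρ.free t hne _ h1)

/-- The image of `∑ h, ρ h` is fixed by every element, so the operator vanishes by freeness. -/
lemma sum_trace_eq_zero [Fintype H] [Nontrivial H] :
    ∑ h : H, LinearMap.trace ℂ C3 (ρ h) = 0 := by
  obtain ⟨g, hg⟩ := exists_ne (1 : H)
  have h0 : ∑ h : H, ρ h = 0 := by
    refine LinearMap.ext fun v => ?_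
    refine hρ.free g hg _ ?_
    have : ρ g * ∑ h : H, ρ h = ∑ h : H, ρ h := by
      rw [Finset.mul_sum]
      simp only [← map_mul]
      exact Fintype.sum_equiv (Equiv.mulLeft g) _ _ fun h => rfl
    rw [← Module.End.mul_apply, this]
  rw [← map_sum, h0, map_zero]

/-- A finite group with a free representation and a common eigenvector is cyclic. -/
lemma isCyclic_of_common_eigenvector [Finite H] {v : C3} (hv : v ≠ 0) {χ : H → ℂ}
    (hχ : ∀ h, ρ h v = χ h • v) : IsCyclic H := by
  have hinj := smul_left_injective ℂ hv
  let f : H →* ℂ :=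
    { toFun := χ
      map_one' := hinj (by simp [← hχ])
      map_mul' := fun x y => hinj (by
        show χ (x * y) • v = (χ x * χ y) • v
        rw [← hχ, map_mul, Module.End.mul_apply, hχ y, map_smul, hχ x, smul_smul, mul_comm]) }
  refine isCyclic_of_injective_ringHom f ((injective_iff_map_eq_one f).2 fun h hh => ?_)
  by_contra hne
  refine hv (hρ.free h hne v ?_)
  rw [hχ, show χ h = 1 from hh, one_smul]

end IsFreeIntegralRep

/-- The three numbers are all the roots of `X ^ 3 - a ^ 3`. This computes the determinant of an
element of order 9 whose cube is scalar. -/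
lemma mul_eq_cube_of_distinct_cube_roots {a b c : ℂ} (hab : a ≠ b) (hac : a ≠ c) (hbc : b ≠ c)
    (h1 : a ^ 3 = b ^ 3) (h2 : a ^ 3 = c ^ 3) : a * b * c = a ^ 3 := by
  have e1 : a ^ 2 + a * b + b ^ 2 = 0 :=
    (mul_eq_zero.1 (show (a - b) * (a ^ 2 + a * b + b ^ 2) = 0 by linear_combination h1)).resolve_left
      (sub_ne_zero.2 hab)
  have e2 : a ^ 2 + a * c + c ^ 2 = 0 :=
    (mul_eq_zero.1 (show (a - c) * (a ^ 2 + a * c + c ^ 2) = 0 by linear_combination h2)).resolve_left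
      (sub_ne_zero.2 hac)
  have e3 : a + b + c = 0 :=
    (mul_eq_zero.1 (show (b - c) * (a + b + c) = 0 by linear_combination e1 - e2)).resolve_left
      (sub_ne_zero.2 hbc)
  linear_combination a * b * e3 - a * e1

lemma IsPrimitiveRoot.add_eq_neg_one_of_three {x y : ℂ} (hx : IsPrimitiveRoot x 3)
    (hy : IsPrimitiveRoot y 3) (hxy : x ≠ y) : x + y = -1 := by
  have h1 : ∀ {z : ℂ}, IsPrimitiveRoot z 3 → z ^ 2 + z + 1 = 0 := fun {z} hz =>
    (mul_eq_zero.1 (show (z - 1) * (z ^ 2 + z + 1) = 0 by linear_combination hz.pow_eq_one)).resolve_left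
      (sub_ne_zero.2 (hz.ne_one (by norm_num)))
  have h2 : (x - y) * (x + y + 1) = 0 := by linear_combination h1 hx - h1 hy
  have h3 := (mul_eq_zero.1 h2).resolve_left (sub_ne_zero.2 hxy)
  linear_combination h3

/-- There are only two primitive cube roots of unity, so three of them either coincide or contain
one value exactly once. The second alternative yields a one-dimensional eigenspace. -/
lemma IsPrimitiveRoot.eq_or_exists_ne_of_three {μ : Fin 3 → ℂ} (h : ∀ i, IsPrimitiveRoot (μ i) 3) :
    (∀ i, μ i = μ 0) ∨ ∃ i, ∀ j, j ≠ i → μ j ≠ μ i := by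
  by_cases h1 : μ 1 = μ 0
  · by_cases h2 : μ 2 = μ 0
    · exact Or.inl fun i => by fin_cases i <;> simp [h1, h2]
    · refine Or.inr ⟨2, fun j hj => ?_⟩
      fin_cases j
      · exact Ne.symm h2
      · simpa [h1] using Ne.symm h2
      · exact absurd rfl hj
  · have e1 := (h 1).add_eq_neg_one_of_three (h 0) h1
    by_cases h2 : μ 2 = μ 0
    · refine Or.inr ⟨1, fun j hj => ?_⟩
      fin_cases j
      · exact Ne.symm h1
      · exact absurd rfl hj
      · simpa [h2] using Ne.symm h1
    · have e2 := (h 2).add_eq_neg_one_of_three (h 0) h2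
      refine Or.inr ⟨0, fun j hj => ?_⟩
      fin_cases j
      · exact absurd rfl hj
      · exact h1
      · exact h2

/-! ### Groups of odd order -/

namespace IsFreeIntegralRep

variable {H : Type*} [Group H] {ρ : H →* Module.End ℂ C3} (hρ : IsFreeIntegralRep ρ)
include hρ

lemma orderOf_mem_of_odd [Finite H] (hodd : Odd (Nat.card H)) (h : H) :
    orderOf h = 1 ∨ orderOf h = 3 ∨ orderOf h = 7 ∨ orderOf h = 9 := by
  have h1 := hρ.orderOf_mem h
  have h2 : Odd (orderOf h) := hodd.of_dvd_nat (orderOf_dvd_natCard h)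
  simp only [Finset.mem_insert, Finset.mem_singleton] at h1
  rcases h1 with h1 | h1 | h1 | h1 | h1 | h1 | h1 | h1 | h1 <;> rw [h1] at h2 ⊢ <;> revert h2 <;>
    decide

/-- In the vanishing sum of traces, twice the real part contributes 6, -3, -1, 0 for elements of
order 1, 3, 7, 9, and no other odd orders occur. -/
lemma card_order_three_add_card_order_seven [Fintype H] [DecidableEq H] [Nontrivial H]
    (hodd : Odd (Nat.card H)) :
    3 * (Finset.univ.filter fun h : H => orderOf h = 3).card +
      (Finset.univ.filter fun h : H => orderOf h = 7).card = 6 := by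
  have h1 := congrArg (fun z : ℂ => 2 * z.re) hρ.sum_trace_eq_zero
  simp only [Complex.re_sum, Finset.mul_sum, Complex.zero_re, mul_zero] at h1
  have h2 : ∀ h : H, 2 * (LinearMap.trace ℂ C3 (ρ h)).re = (if h = 1 then (6 : ℝ) else 0) -
      3 * (if orderOf h = 3 then 1 else 0) - (if orderOf h = 7 then 1 else 0) := by
    intro h
    rcases hρ.orderOf_mem_of_odd hodd h with ho | ho | ho | ho
    · rw [orderOf_eq_one_iff] at ho
      subst ho
      simp
      norm_num
    · have : h ≠ 1 := fun hh => by simp [hh] at ho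
      rw [hρ.two_re_trace_three ho, if_neg this, if_pos ho, if_neg (by omega)]
      norm_num
    · have : h ≠ 1 := fun hh => by simp [hh] at ho
      rw [hρ.two_re_trace_seven ho, if_neg this, if_pos ho, if_neg (by omega)]
      norm_num
    · have : h ≠ 1 := fun hh => by simp [hh] at ho
      rw [hρ.two_re_trace_nine ho, if_neg this, if_neg (by omega), if_neg (by omega)]
      norm_num
  simp only [h2, Finset.sum_sub_distrib, ← Finset.mul_sum, Finset.sum_boole, Finset.sum_ite_eq',
    Finset.mem_univ, if_true] at h1
  have h3 : (3 * (Finset.univ.filter fun h : H => orderOf h = 3).card +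
      (Finset.univ.filter fun h : H => orderOf h = 7).card : ℝ) = 6 := by linarith
  exact_mod_cast h3

/-- For order 9 the multiplicity `k` is 1, so the three eigenvalues are distinct; being cube roots
of `ν`, they are all of them and their product is `ν`. -/
lemma det_eq_of_cube_scalar [Finite H] {y : H} (hy : orderOf y = 9) {ν : ℂ}
    (hν : ρ (y ^ 3) = ν • 1) : LinearMap.det (ρ y) = ν ∧ IsPrimitiveRoot ν 3 := by
  obtain ⟨b, μ, hb, hprim, k, hk, hμ⟩ := hρ.spectrum y
  have hk1 : k = 1 := by
    have : Nat.totient 9 = 6 := by decide +kernel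
    rw [hy, this] at hk
    omega
  rw [hk1, one_smul] at hμ
  have hinj : Function.Injective μ := by
    have h1 : (Finset.univ.val.map μ).Nodup :=
      Multiset.nodup_of_le (Multiset.le_add_right _ _) (hμ ▸ Finset.nodup _)
    exact fun i j hij => Multiset.inj_on_of_nodup_map h1 i (Finset.mem_univ i) j (Finset.mem_univ j) hij
  have hcube : ∀ i, μ i ^ 3 = ν := fun i => by
    have := pow_apply (hb i) 3
    rw [hν] at this
    exact (smul_left_injective ℂ (b.ne_zero i) this).symm
  refine ⟨?_, ?_⟩
  · rw [det_eq_prod_of_eigenbasis hb, Fin.prod_univ_three, mul_eq_cube_of_distinct_cube_roots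
      (hinj.ne (by decide)) (hinj.ne (by decide)) (hinj.ne (by decide))
      ((hcube 0).trans (hcube 1).symm) ((hcube 0).trans (hcube 2).symm), hcube]
  · rw [← hcube 0]
    exact (hprim 0).pow (by rw [hy]; norm_num) (by rw [hy])

/-- The determinant does the work. It is 1 on elements of order 3, which are scalar, and a primitive
cube root of unity on elements of order 9. Its kernel is thus generated by `z`, which is itself a
power of any element `y` of order 9; if there is no such `y`, then `z` generates. -/
lemma isCyclic_of_odd_of_scalar [Finite H] (hodd : Odd (Nat.card H)) {z : H} (hz : orderOf z = 3)
    (hz3 : ∀ h : H, orderOf h = 3 → h = z ∨ h = z ^ 2) (h7 : ∀ h : H, orderOf h ≠ 7) {μ : ℂ}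
    (hμ : IsPrimitiveRoot μ 3) (hzμ : ρ z = μ • 1) : IsCyclic H := by
  have hz2 : ρ (z ^ 2) = μ ^ 2 • 1 := by rw [map_pow, hzμ, smul_pow, one_pow]
  have hdet : ∀ ν : ℂ, LinearMap.det (ν • (1 : Module.End ℂ C3)) = ν ^ 3 := fun ν => by
    rw [LinearMap.det_smul]
    simp
  by_cases h9 : ∃ y : H, orderOf y = 9
  · have hcube : ∀ y : H, orderOf y = 9 → y ^ 3 = z ∨ y ^ 3 = z ^ 2 := fun y hy =>
      hz3 _ (by rw [orderOf_pow, hy]; norm_num)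
    have hdet9 : ∀ y : H, orderOf y = 9 → IsPrimitiveRoot (LinearMap.det (ρ y)) 3 := by
      intro y hy
      rcases hcube y hy with h | h
      · have := hρ.det_eq_of_cube_scalar hy (ν := μ) (by rw [h, hzμ])
        rw [this.1]
        exact this.2
      · have := hρ.det_eq_of_cube_scalar hy (ν := μ ^ 2) (by rw [h, hz2])
        rw [this.1]
        exact this.2
    have hdet3 : ∀ y : H, orderOf y = 3 → LinearMap.det (ρ y) = 1 := by
      intro y hy
      rcases hz3 y hy with rfl | rfl
      · rw [hzμ, hdet, hμ.pow_eq_one]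
      · rw [hz2, hdet, ← pow_mul, mul_comm, pow_mul, hμ.pow_eq_one, one_pow]
    have hker : ∀ h : H, LinearMap.det (ρ h) = 1 → h ∈ Subgroup.zpowers z := by
      intro h hh
      rcases hρ.orderOf_mem_of_odd hodd h with ho | ho | ho | ho
      · rw [orderOf_eq_one_iff.1 ho]
        exact one_mem _
      · rcases hz3 h ho with rfl | rfl
        · exact Subgroup.mem_zpowers _
        · exact pow_mem (Subgroup.mem_zpowers _) 2
      · exact absurd ho (h7 h)
      · exact absurd hh ((hdet9 h ho).ne_one (by norm_num))
    have hdetcube : ∀ h : H, LinearMap.det (ρ h) ^ 3 = 1 := by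
      intro h
      rcases hρ.orderOf_mem_of_odd hodd h with ho | ho | ho | ho
      · rw [orderOf_eq_one_iff.1 ho]
        simp
      · rw [hdet3 h ho, one_pow]
      · exact absurd ho (h7 h)
      · exact (hdet9 h ho).pow_eq_one
    obtain ⟨y, hy⟩ := h9
    have hzy : z ∈ Subgroup.zpowers y := by
      rcases hcube y hy with h | h
      · rw [← h]
        exact pow_mem (Subgroup.mem_zpowers _) 3
      · have : z = (y ^ 3) ^ 2 := by
          rw [h, ← pow_mul, pow_succ, ← hz, pow_orderOf_eq_one, one_mul]
        rw [this]
        exact pow_mem (pow_mem (Subgroup.mem_zpowers _) 3) 2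
    refine ⟨y, fun h => ?_⟩
    -- Dividing `h` by a power of `y` with the same determinant lands in the kernel.
    obtain ⟨j, -, hj⟩ := (hdet9 y hy).eq_pow_of_pow_eq_one (hdetcube h)
    have h1 : LinearMap.det (ρ (h * (y ^ j)⁻¹)) = 1 := by
      have h2 : LinearMap.det (ρ (h * (y ^ j)⁻¹)) * LinearMap.det (ρ (y ^ j)) =
          LinearMap.det (ρ h) := by
        rw [← map_mul, ← map_mul, inv_mul_cancel_right]
      have h3 : LinearMap.det (ρ (y ^ j)) = LinearMap.det (ρ h) := by rw [map_pow, map_pow, hj]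
      rw [h3] at h2
      have h4 : LinearMap.det (ρ h) ≠ 0 := fun h0 => by simpa [h0] using hdetcube h
      exact mul_right_cancel₀ h4 (h2.trans (one_mul _).symm)
    have h2 : h * (y ^ j)⁻¹ ∈ Subgroup.zpowers y := Subgroup.zpowers_le.2 hzy (hker _ h1)
    have h3 := mul_mem h2 (pow_mem (Subgroup.mem_zpowers y) j)
    rwa [inv_mul_cancel_right] at h3
  · refine ⟨z, fun h => ?_⟩
    rcases hρ.orderOf_mem_of_odd hodd h with ho | ho | ho | ho
    · rw [orderOf_eq_one_iff.1 ho]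
      exact (one_mem _ : (1 : H) ∈ Subgroup.zpowers z)
    · rcases hz3 h ho with rfl | rfl
      · exact Subgroup.mem_zpowers _
      · exact pow_mem (Subgroup.mem_zpowers _) 2
    · exact absurd ho (h7 h)
    · exact absurd ⟨h, ho⟩ h9

/-- Conjugation by `k` sends `z` to `z` or `z ^ 2`, so `k ^ 2` commutes with `z`. As `k` has odd
order it is a power of `k ^ 2`, and `z` is central. The eigenspaces of `z` are then stable under the
group: either `z` is scalar, or some eigenspace is a line and gives a faithful character. -/
lemma isCyclic_of_odd_of_order_three [Finite H] (hodd : Odd (Nat.card H)) {z : H}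
    (hz : orderOf z = 3) (hz3 : ∀ h : H, orderOf h = 3 → h = z ∨ h = z ^ 2)
    (h7 : ∀ h : H, orderOf h ≠ 7) : IsCyclic H := by
  have hz3' : z ^ 3 = 1 := by rw [← hz, pow_orderOf_eq_one]
  have hcomm : ∀ k : H, k * z = z * k := by
    intro k
    have ho : orderOf (k * z * k⁻¹) = 3 := by
      rw [← hz]
      exact orderOf_injective (MulAut.conj k).toMonoidHom (MulAut.conj k).injective z
    rcases hz3 _ ho with h | h
    · exact mul_inv_eq_iff_eq_mul.1 h
    · have h2 : Commute (k ^ 2) z := by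
        have h3 : k * z = z ^ 2 * k := mul_inv_eq_iff_eq_mul.1 h
        show k ^ 2 * z = z * k ^ 2
        calc k ^ 2 * z = k * (k * z) := by rw [sq, mul_assoc]
          _ = k * (z ^ 2 * k) := by rw [h3]
          _ = (k * z) * (z * k) := by simp only [sq, mul_assoc]
          _ = z ^ 2 * k * (z * k) := by rw [h3]
          _ = z ^ 2 * (k * z) * k := by simp only [mul_assoc]
          _ = z ^ 2 * (z ^ 2 * k) * k := by rw [h3]
          _ = z ^ 3 * (z * k ^ 2) := by simp only [pow_succ, pow_zero, one_mul, mul_assoc]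
          _ = z * k ^ 2 := by rw [hz3', one_mul]
      obtain ⟨m, hm⟩ := hodd.of_dvd_nat (orderOf_dvd_natCard k)
      have h4 : (k ^ 2) ^ (m + 1) = k := by
        have : k ^ (2 * m + 1) = 1 := by rw [← hm, pow_orderOf_eq_one]
        rw [← pow_mul, mul_add, mul_one, show 2 * m + 2 = (2 * m + 1) + 1 by ring, pow_succ, this,
          one_mul]
      have h5 := h2.pow_left (m + 1)
      rw [h4] at h5
      exact h5
  obtain ⟨b, μ, hb, hprim, -⟩ := hρ.spectrum z
  rw [hz] at hprim
  rcases IsPrimitiveRoot.eq_or_exists_ne_of_three hprim with hall | ⟨i, hi⟩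
  · refine hρ.isCyclic_of_odd_of_scalar hodd hz hz3 h7 (hprim 0) (b.ext fun i => ?_)
    rw [hb, hall]
    rfl
  · refine hρ.isCyclic_of_common_eigenvector (b.ne_zero i)
      (χ := fun k => b.repr (ρ k (b i)) i) fun k => ?_
    have h1 : ρ z (ρ k (b i)) = μ i • ρ k (b i) := by
      rw [← Module.End.mul_apply, ← map_mul, ← hcomm, map_mul, Module.End.mul_apply, hb, map_smul]
    refine b.ext_elem fun j => ?_
    rw [map_smul, Finsupp.smul_apply, Module.Basis.repr_self, Finsupp.single_apply]
    by_cases hij : i = j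
    · simp [hij]
    · have h2 : b.repr (ρ z (ρ k (b i))) j = μ j * b.repr (ρ k (b i)) j := by
        rw [← LinearMap.toMatrix_mulVec_repr b b, toMatrix_eq_diagonal hb, Matrix.mulVec_diagonal]
      rw [h1, map_smul, Finsupp.smul_apply, smul_eq_mul] at h2
      have h3 : (μ j - μ i) * b.repr (ρ k (b i)) j = 0 := by rw [sub_mul, ← h2, sub_self]
      rw [(mul_eq_zero.1 h3).resolve_left (sub_ne_zero.2 (hi j (Ne.symm hij))), if_neg hij, smul_zero]

/-- An element `z` of order 3 brings `z ^ 2` along, so `3 n₃ + n₇ = 6` leaves either `n₃ = 2`, `n₇ =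
0` or `n₃ = 0`, `n₇ = 6`. In the latter case there is no element of order 9 either, and the group
has order 7. -/
lemma isCyclic_of_odd [Finite H] (hodd : Odd (Nat.card H)) : IsCyclic H := by
  classical
  have := Fintype.ofFinite H
  rcases subsingleton_or_nontrivial H with hs | hn
  · infer_instance
  have hsum := hρ.card_order_three_add_card_order_seven hodd
  by_cases h3 : ∃ z : H, orderOf z = 3
  · obtain ⟨z, hz⟩ := h3
    have hz2 : orderOf (z ^ 2) = 3 := by rw [orderOf_pow, hz]; norm_num
    have hne : z ≠ z ^ 2 := fun h => by
      have : z = 1 := by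
        rw [sq] at h
        exact left_eq_mul.1 h
      simp [this] at hz
    have hsub : ({z, z ^ 2} : Finset H) ⊆ Finset.univ.filter fun h : H => orderOf h = 3 := by
      intro x hx
      simp only [Finset.mem_insert, Finset.mem_singleton] at hx
      rcases hx with rfl | rfl <;> simp [hz, hz2]
    have hcard := Finset.card_le_card hsub
    rw [Finset.card_pair hne] at hcard
    have heq := Finset.eq_of_subset_of_card_le hsub (by rw [Finset.card_pair hne]; omega)
    have h7 : (Finset.univ.filter fun h : H => orderOf h = 7) = ∅ :=
      Finset.card_eq_zero.1 (by omega)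
    refine hρ.isCyclic_of_odd_of_order_three hodd hz (fun h hh => ?_) (fun h hh => ?_)
    · have : h ∈ ({z, z ^ 2} : Finset H) := heq ▸ by simp [hh]
      simpa using this
    · have : h ∈ (Finset.univ.filter fun h : H => orderOf h = 7) := by simp [hh]
      simp [h7] at this
  · push Not at h3
    have h30 : (Finset.univ.filter fun h : H => orderOf h = 3) = ∅ := by
      ext h
      simp [h3 h]
    rw [h30, Finset.card_empty, mul_zero, zero_add] at hsum
    have h7 : (Finset.univ.filter fun h : H => orderOf h = 7) = Finset.univ.erase 1 := by
      ext h
      simp only [Finset.mem_filter, Finset.mem_univ, true_and, Finset.mem_erase, and_true]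
      refine ⟨fun ho hh => by simp [hh] at ho, fun hh => ?_⟩
      rcases hρ.orderOf_mem_of_odd hodd h with ho | ho | ho | ho
      · exact absurd (orderOf_eq_one_iff.1 ho) hh
      · exact absurd ho (h3 h)
      · exact ho
      · exact absurd (by rw [orderOf_pow, ho]; norm_num) (h3 (h ^ 3))
    rw [h7, Finset.card_erase_of_mem (Finset.mem_univ _), Finset.card_univ] at hsum
    have : Fact (Nat.Prime 7) := ⟨by norm_num⟩
    exact isCyclic_of_prime_card (p := 7) (by rw [Nat.card_eq_fintype_card]; omega)

end IsFreeIntegralRep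

/-! ### Reduction of the general case to odd order -/

namespace IsFreeIntegralRep

variable {H : Type*} [Group H] {ρ : H →* Module.End ℂ C3} (hρ : IsFreeIntegralRep ρ)
include hρ

/-- An element of odd order which is conjugate to its inverse is trivial. -/
lemma eq_one_of_conj_eq_inv [Finite H] {s k : H} (hk : Odd (orderOf k))
    (hs : s⁻¹ * k * s = k⁻¹) : k = 1 := by
  by_contra hne
  obtain ⟨b, μ, hb, hprim, -⟩ := hρ.spectrum k
  have hne1 : ∀ i, μ i ≠ 1 := fun i h => by
    have h1 := hprim i
    rw [h] at h1
    exact hne (orderOf_eq_one_iff.1 (h1.unique IsPrimitiveRoot.one))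
  have hsq : ∀ {w : ℂ}, w ^ orderOf k = 1 → w ^ 2 = 1 → w = 1 := by
    intro w h1 h2
    obtain ⟨m, hm⟩ := hk
    rwa [hm, pow_succ, pow_mul, h2, one_pow, one_mul] at h1
  -- Conjugacy with the inverse gives `det ^ 2 = 1`, and the odd order removes the sign.
  have hdet : LinearMap.det (ρ k) = 1 := by
    have h1 : LinearMap.det (ρ k) = LinearMap.det (ρ k⁻¹) := by
      have h2 : LinearMap.det (ρ s⁻¹) * LinearMap.det (ρ s) = 1 := by
        rw [← map_mul, ← map_mul, inv_mul_cancel, map_one, map_one]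
      rw [← hs, map_mul, map_mul, map_mul, map_mul]
      linear_combination (-LinearMap.det (ρ k)) * h2
    have h2 : LinearMap.det (ρ k) * LinearMap.det (ρ k⁻¹) = 1 := by
      rw [← map_mul, ← map_mul, mul_inv_cancel, map_one, map_one]
    refine hsq ?_ (by rw [sq]; nth_rewrite 2 [h1]; exact h2)
    rw [← map_pow, ← map_pow, pow_orderOf_eq_one, map_one, map_one]
  rw [det_eq_prod_of_eigenbasis hb, Fin.prod_univ_three] at hdet
  have hμ0 : μ 0 ≠ 0 := (hprim 0).ne_zero (orderOf_pos k).ne'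
  -- `ρ s` carries the eigenvector for `μ 0` to one for its inverse. If `i = 0`, then `μ 0` would be
  -- 1; otherwise the third eigenvalue equals the determinant, that is 1. Both contradict freeness.
  obtain ⟨i, hi⟩ : ∃ i, μ i = (μ 0)⁻¹ := by
    have hks : k * s = s * k⁻¹ := by rw [← hs]; group
    refine exists_eq_of_eigenvector hb (v := ρ s (b 0)) (fun h0 => ?_) ?_
    · have : ρ s⁻¹ (ρ s (b 0)) = b 0 := by
        rw [← Module.End.mul_apply, ← map_mul, inv_mul_cancel, map_one, Module.End.one_apply]
      rw [h0, map_zero] at this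
      exact b.ne_zero 0 this.symm
    · have h1 : ρ k⁻¹ (b 0) = (μ 0)⁻¹ • b 0 := by
        have h2 : ρ k⁻¹ (ρ k (b 0)) = b 0 := by
          rw [← Module.End.mul_apply, ← map_mul, inv_mul_cancel, map_one, Module.End.one_apply]
        rw [hb, map_smul] at h2
        rw [← h2, smul_smul, inv_mul_cancel₀ hμ0, one_smul, h2]
      rw [← Module.End.mul_apply, ← map_mul, hks, map_mul, Module.End.mul_apply, h1, map_smul]
  fin_cases i
  · have h1 : μ 0 ^ 2 = 1 := by
      have : μ 0 = (μ 0)⁻¹ := hi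
      rw [sq]; nth_rewrite 2 [this]; exact mul_inv_cancel₀ hμ0
    exact hne1 0 (hsq (hprim 0).pow_eq_one h1)
  · have h1 : μ 1 = (μ 0)⁻¹ := hi
    rw [h1, mul_inv_cancel₀ hμ0, one_mul] at hdet
    exact hne1 2 hdet
  · have h1 : μ 2 = (μ 0)⁻¹ := hi
    rw [h1, mul_right_comm, mul_inv_cancel₀ hμ0, one_mul] at hdet
    exact hne1 1 hdet

/-- A finite group with a free integral representation on `ℂ³` is cyclic. -/
lemma isCyclic [Finite H] : IsCyclic H := by
  -- The exponent 63 is odd, so involutions go to -1 and the kernel has odd order. Moreover 126 = 2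
  -- · 63 is a multiple of every admissible order except 4, so `δ ^ 2 = 1` away from elements of
  -- order 4.
  let δ : H →* ℂ := (powMonoidHom 63).comp ((LinearMap.det).comp ρ)
  have hδ : ∀ h, δ h = LinearMap.det (ρ h) ^ 63 := fun h => rfl
  have hδinv : ∀ t : H, orderOf t = 2 → δ t = -1 := by
    intro t ht
    rw [hδ, hρ.apply_eq_neg_one_of_orderOf_two ht, ← neg_one_smul ℂ (1 : Module.End ℂ C3),
      LinearMap.det_smul]
    norm_num
  have hK : Odd (Nat.card δ.ker) := by
    rw [← Nat.not_even_iff_odd, even_iff_two_dvd]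
    intro h2
    have : Fact (Nat.Prime 2) := ⟨Nat.prime_two⟩
    obtain ⟨t, ht⟩ := exists_prime_orderOf_dvd_card' 2 h2
    have h3 := hδinv t (by rw [← ht]; exact Subgroup.orderOf_coe t)
    rw [MonoidHom.mem_ker.1 t.2] at h3
    norm_num at h3
  have h126 : ∀ h : H, δ h ^ 2 ≠ 1 → orderOf h = 4 := by
    intro h hh
    have h1 : ¬ orderOf h ∣ 126 := fun hd => hh (by
      rw [hδ, ← pow_mul, ← map_pow, ← map_pow, orderOf_dvd_iff_pow_eq_one.1 hd, map_one, map_one])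
    have h2 := hρ.orderOf_mem h
    simp only [Finset.mem_insert, Finset.mem_singleton] at h2
    rcases h2 with h2 | h2 | h2 | h2 | h2 | h2 | h2 | h2 | h2 <;> rw [h2] at h1 ⊢ <;> revert h1 <;>
      decide
  by_cases hs : ∃ s, δ s ^ 2 ≠ 1
  · obtain ⟨s, hs⟩ := hs
    have hsq : ∀ h : H, δ h ^ 2 ≠ 1 → ρ (h ^ 2) = -1 := fun h hh =>
      hρ.apply_eq_neg_one_of_orderOf_two (by rw [orderOf_pow, h126 h hh]; norm_num)
    refine isCyclic_of_injective_ringHom δ ((injective_iff_map_eq_one δ).2 fun k hk => ?_)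
    -- Both `s` and `s * k` have order 4, so both squares act as -1. Hence conjugation by `s`
    -- inverts `k`, which forces `k = 1`.
    have h1 : (s * k) ^ 2 = s ^ 2 := hρ.injective (by
      rw [hsq s hs, hsq (s * k) (by rwa [map_mul, hk, mul_one])])
    have h2 : k * s * k = s := by
      rw [sq, sq, mul_assoc] at h1
      have := mul_left_cancel h1
      rwa [← mul_assoc] at this
    refine hρ.eq_one_of_conj_eq_inv (s := s) ?_ ?_
    · have := hK.of_dvd_nat (orderOf_dvd_natCard (⟨k, hk⟩ : δ.ker))
      rwa [← Subgroup.orderOf_coe] at this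
    · rw [eq_inv_iff_mul_eq_one, mul_assoc, mul_assoc, ← mul_assoc k, h2, inv_mul_cancel]
  · push Not at hs
    obtain ⟨⟨y, hyK⟩, hy⟩ := (hρ.comp δ.ker.subtype Subtype.val_injective).isCyclic_of_odd hK
    have hyodd : Odd (orderOf y) := by
      have := hK.of_dvd_nat (orderOf_dvd_natCard (⟨y, hyK⟩ : δ.ker))
      rwa [Subgroup.orderOf_mk] at this
    have hy' : ∀ h, δ h = 1 → h ∈ Subgroup.zpowers y := by
      intro h hh
      obtain ⟨m, hm⟩ := hy ⟨h, hh⟩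
      exact ⟨m, congrArg Subtype.val hm⟩
    by_cases htriv : ∀ h, δ h = 1
    · exact ⟨y, fun h => hy' h (htriv h)⟩
    · push Not at htriv
      obtain ⟨g, hg⟩ := htriv
      have hg2 : 2 ∣ Nat.card H := by
        by_contra h2
        have hodd : Odd (orderOf g) :=
          (Nat.odd_iff.2 (Nat.two_dvd_ne_zero.1 h2)).of_dvd_nat (orderOf_dvd_natCard g)
        obtain ⟨m, hm⟩ := hodd
        have h3 : δ g ^ orderOf g = 1 := by rw [← map_pow, pow_orderOf_eq_one, map_one]
        rw [hm, pow_succ, pow_mul, hs, one_pow, one_mul] at h3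
        exact hg h3
      have : Fact (Nat.Prime 2) := ⟨Nat.prime_two⟩
      obtain ⟨t, ht⟩ := exists_prime_orderOf_dvd_card' 2 hg2
      -- With `δ = ±1`, the group is the product of the odd cyclic kernel, generated by `y`, and the
      -- central involution `t`; the orders are coprime, so `t * y` generates.
      have hcomm : Commute t y := hρ.injective (by
        rw [map_mul, map_mul, hρ.apply_eq_neg_one_of_orderOf_two ht]
        exact LinearMap.ext fun v => by simp)
      have htt : t * t = 1 := by rw [← sq, ← ht, pow_orderOf_eq_one]
      have hyz : y ∈ Subgroup.zpowers (t * y) := by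
        obtain ⟨m, hm⟩ := hyodd
        have h1 : (t * y) ^ 2 = y ^ 2 := by rw [hcomm.mul_pow, sq t, htt, one_mul]
        have h2 : ((t * y) ^ 2) ^ (m + 1) = y := by
          have : y ^ (2 * m + 1) = 1 := by rw [← hm, pow_orderOf_eq_one]
          rw [h1, ← pow_mul, mul_add, mul_one, show 2 * m + 2 = (2 * m + 1) + 1 by ring, pow_succ,
            this, one_mul]
        have h3 := pow_mem (pow_mem (Subgroup.mem_zpowers (t * y)) 2) (m + 1)
        rwa [h2] at h3
      have htz : t ∈ Subgroup.zpowers (t * y) := by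
        have := mul_mem (Subgroup.mem_zpowers (t * y)) (inv_mem hyz)
        rwa [mul_inv_cancel_right] at this
      have hker : ∀ h, δ h = 1 → h ∈ Subgroup.zpowers (t * y) := fun h hh =>
        Subgroup.zpowers_le.2 hyz (hy' h hh)
      refine ⟨t * y, fun h => ?_⟩
      rcases sq_eq_one_iff.1 (hs h) with hh | hh
      · exact hker h hh
      · have h1 : t * h ∈ Subgroup.zpowers (t * y) :=
          hker _ (by rw [map_mul, hδinv t ht, hh]; norm_num)
        have h2 := mul_mem htz h1
        rwa [← mul_assoc, htt, one_mul] at h2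

end IsFreeIntegralRep

/-! ### Normal forms -/

/-- The types of cyclic quotient singularities occurring in canonical quotients. -/
def canonicalTypes : List (ℕ × (Fin 3 → ℕ)) :=
  [(2, ![1, 1, 1]), (3, ![1, 1, 2]), (4, ![1, 1, 3]), (6, ![1, 1, 5]),
    (3, ![1, 1, 1]), (7, ![1, 2, 4]), (9, ![1, 4, 7]), (14, ![1, 9, 11])]

/-- The types of non-canonical cyclic quotient singularities given by free integral
representations. -/
def noncanonicalTypes : List (ℕ × (Fin 3 → ℕ)) :=
  [(4, ![1, 1, 1]), (6, ![1, 1, 1]), (7, ![1, 2, 3]), (9, ![1, 2, 4]), (14, ![1, 3, 5]),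
    (18, ![1, 5, 7]), (18, ![1, 7, 13])]

/-- Multiplication by the unit `u` changes the generator and `σ` reorders the coordinates. For `φ(d)
= 6` the extra condition expresses that the six residues `± cᵢ` are distinct; for `φ(d) ≤ 2` no
condition is needed. -/
lemma exists_normalized_exponents : ∀ d ∈ ({2, 3, 4, 6, 7, 9, 14, 18} : Finset ℕ),
    ∀ c₀ ∈ (Finset.range d).filter d.Coprime, ∀ c₁ ∈ (Finset.range d).filter d.Coprime,
    ∀ c₂ ∈ (Finset.range d).filter d.Coprime,
    (d.totient = 6 → c₀ ≠ c₁ ∧ c₀ ≠ c₂ ∧ c₁ ≠ c₂ ∧ c₀ + c₁ ≠ d ∧ c₀ + c₂ ≠ d ∧ c₁ + c₂ ≠ d) →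
    ∃ u ∈ (Finset.range d).filter d.Coprime, ∃ σ : Equiv.Perm (Fin 3),
      (d, fun i => u * ![c₀, c₁, c₂] (σ i) % d) ∈ canonicalTypes ++ noncanonicalTypes := by
  decide +kernel

namespace IsFreeIntegralRep

variable {H : Type*} [Group H] {ρ : H →* Module.End ℂ C3} (hρ : IsFreeIntegralRep ρ)
include hρ

lemma exists_exponents [Finite H] (g : H) {ζ : ℂ} (hζ : IsPrimitiveRoot ζ (orderOf g)) :
    ∃ (b : Module.Basis (Fin 3) ℂ C3) (c : Fin 3 → ℕ), (∀ i, ρ g (b i) = ζ ^ c i • b i) ∧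
      (∀ i, c i ∈ (Finset.range (orderOf g)).filter (orderOf g).Coprime) ∧
      ((orderOf g).totient = 6 → ∀ i j, i ≠ j → c i ≠ c j ∧ c i + c j ≠ orderOf g) := by
  obtain ⟨b, μ, hb, hprim, k, hk, hμ⟩ := hρ.spectrum g
  have : NeZero (orderOf g) := ⟨(orderOf_pos g).ne'⟩
  choose c hlt hcop hc using fun i => hζ.isPrimitiveRoot_iff.1 (hprim i)
  refine ⟨b, c, fun i => by rw [hb, hc], fun i => ?_, fun ht i j hij => ?_⟩
  · exact Finset.mem_filter.2 ⟨Finset.mem_range.2 (hlt i), (hcop i).symm⟩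
  · have hk1 : k = 1 := by rw [ht] at hk; omega
    rw [hk1, one_smul] at hμ
    have hnd : (Finset.univ.val.map μ + Finset.univ.val.map fun i => (μ i)⁻¹).Nodup :=
      hμ ▸ Finset.nodup _
    obtain ⟨h1, -, h3⟩ := Multiset.nodup_add.1 hnd
    refine ⟨fun hcc => hij (Multiset.inj_on_of_nodup_map h1 i (Finset.mem_univ i) j
      (Finset.mem_univ j) (by rw [← hc, ← hc, hcc])), fun hcc => ?_⟩
    refine Multiset.disjoint_left.1 h3 (Multiset.mem_map_of_mem μ (Finset.mem_univ i))
      (Multiset.mem_map.2 ⟨j, Finset.mem_univ j, ?_⟩)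
    rw [inv_eq_iff_eq_inv, ← mul_eq_one_iff_eq_inv₀ ((hprim i).ne_zero (orderOf_pos g).ne'),
      mul_comm, ← hc, ← hc, ← pow_add, hcc, hζ.pow_eq_one]

/-- A non-trivial finite group with a free integral representation on `ℂ³` is generated by an
element which is diagonal, of one of finitely many types, in suitable coordinates. -/
lemma exists_normal_form [Finite H] [Nontrivial H] :
    ∃ (g : H) (L : C3 ≃L[ℂ] C3) (a : Fin 3 → ℕ), (∀ h, h ∈ Submonoid.powers g) ∧
      orderOf g = Nat.card H ∧ (Nat.card H, a) ∈ canonicalTypes ++ noncanonicalTypes ∧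
      ∀ x, ρ g (L x) =
        L fun i => Complex.exp (2 * Real.pi * Complex.I / (Nat.card H : ℕ)) ^ a i * x i := by
  obtain ⟨g, hg⟩ := hρ.isCyclic
  have hord : orderOf g = Nat.card H := orderOf_eq_card_of_forall_mem_zpowers hg
  have hd1 : orderOf g ≠ 1 := by
    rw [hord]
    exact Finite.one_lt_card.ne'
  have hζ := Complex.isPrimitiveRoot_exp (orderOf g) (orderOf_pos g).ne'
  obtain ⟨b, c, hb, hc, hc6⟩ := hρ.exists_exponents g hζ
  have hmem : orderOf g ∈ ({2, 3, 4, 6, 7, 9, 14, 18} : Finset ℕ) := by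
    have := hρ.orderOf_mem g
    rw [Finset.mem_insert] at this
    exact this.resolve_left hd1
  obtain ⟨u, hu, σ, hσ⟩ := exists_normalized_exponents _ hmem (c 0) (hc 0) (c 1) (hc 1) (c 2) (hc 2)
    (fun ht => ⟨(hc6 ht 0 1 (by decide)).1, (hc6 ht 0 2 (by decide)).1, (hc6 ht 1 2 (by decide)).1,
      (hc6 ht 0 1 (by decide)).2, (hc6 ht 0 2 (by decide)).2, (hc6 ht 1 2 (by decide)).2⟩)
  have hcc : ![c 0, c 1, c 2] = c := by
    ext i
    fin_cases i <;> rfl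
  rw [hcc] at hσ
  have hu' : (orderOf g).Coprime u := (Finset.mem_filter.1 hu).2
  have hordu : orderOf (g ^ u) = orderOf g := hu'.orderOf_pow
  refine ⟨g ^ u, (b.reindex σ.symm).equivFun.symm.toContinuousLinearEquiv,
    fun i => u * c (σ i) % orderOf g, fun h => ?_, by rw [hordu, hord], by rwa [← hord],
    fun x => ?_⟩
  · have : Subgroup.zpowers (g ^ u) = ⊤ :=
      Subgroup.eq_top_of_card_eq _ (by rw [Nat.card_zpowers, hordu, hord])
    rw [mem_powers_iff_mem_zpowers, this]
    trivial
  · have h1 : ∀ i, ρ (g ^ u) (b (σ i)) =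
        Complex.exp (2 * Real.pi * Complex.I / (Nat.card H : ℕ)) ^ (u * c (σ i) % orderOf g) •
          b (σ i) := fun i => by
      rw [pow_apply (hb (σ i)), ← hord, ← pow_mul, mul_comm (c (σ i)),
        ← pow_mod_orderOf _ (u * c (σ i)), hζ.eq_orderOf.symm]
    simp only [LinearEquiv.coe_toContinuousLinearEquiv', Module.Basis.equivFun_symm_apply,
      Module.Basis.reindex_apply, Equiv.symm_symm, map_sum, map_smul, h1, smul_smul]
    simp only [mul_comm (x _)]

end IsFreeIntegralRep

/-! ### Holomorphic group actions on complex tori -/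

section Torus

variable {Λ : Submodule ℤ C3}

lemma torusMk_eq_iff {z w : C3} : torusMk Λ z = torusMk Λ w ↔ z - w ∈ Λ :=
  Submodule.Quotient.eq Λ

lemma torusMk_surjective : Function.Surjective (torusMk Λ) :=
  Submodule.Quotient.mk_surjective Λ

lemma continuous_torusMk : Continuous (torusMk Λ) := continuous_quotient_mk'

lemma isOpenMap_torusMk : IsOpenMap (torusMk Λ) := Λ.isOpenMap_mkQ

lemma torusMk_add_of_mem {l : C3} (hl : l ∈ Λ) (z : C3) : torusMk Λ (z + l) = torusMk Λ z :=
  torusMk_eq_iff.2 (by simpa using hl)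

variable [DiscreteTopology Λ]

variable (Λ) in
lemma exists_forall_mem_lattice_eq_zero : ∃ ε > 0, ∀ l ∈ Λ, ‖l‖ < ε → l = 0 := by
  obtain ⟨ε, hε, h⟩ := Metric.exists_ball_inter_eq_singleton_of_mem_discrete
    (s := (Λ : Set C3)) (x := 0) (isDiscrete_iff_discreteTopology.2 ‹_›) Λ.zero_mem
  refine ⟨ε, hε, fun l hl hn => ?_⟩
  have : l ∈ Metric.ball (0 : C3) ε ∩ Λ := ⟨by simpa using hn, hl⟩
  rw [h] at this
  simpa using this

variable (Λ) in
lemma isClosed_lattice : IsClosed (Λ : Set C3) :=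
  AddSubgroup.isClosed_of_discrete (H := Λ.toAddSubgroup)

instance torus_t2Space : T2Space (C3 ⧸ Λ) := by
  have := isClosed_lattice Λ
  infer_instance

lemma isCoveringMap_torusMk : IsCoveringMap (torusMk Λ) :=
  (AddSubgroup.isAddQuotientCoveringMap_of_comm Λ.toAddSubgroup
    (isDiscrete_iff_discreteTopology.2 ‹_›)).isCoveringMap

/-- A continuous function with values in a lattice is constant. -/
lemma eq_of_continuous_of_mem_lattice {D : C3 → C3} (hD : Continuous D) (h : ∀ z, D z ∈ Λ)
    (z w : C3) : D z = D w := by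
  have := PreconnectedSpace.constant (f := fun z => (⟨D z, h z⟩ : Λ)) inferInstance
    (hD.subtype_mk h) (x := z) (y := w)
  exact congrArg Subtype.val this

open Classical in
/-- The local coordinate `w ↦ w i` of the torus around the image of `y₀`, extended by zero. -/
lemma exists_local_coordinate (y₀ : C3) (i : Fin 3) : ∃ h : C3 ⧸ Λ → ℂ,
    HolFunAt (torusMk Λ) (torusMk Λ y₀) h ∧ ∀ᶠ w in 𝓝 y₀, h (torusMk Λ w) = w i := by
  obtain ⟨ε, hε, hΛ⟩ := exists_forall_mem_lattice_eq_zero Λ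
  let h : C3 ⧸ Λ → ℂ := fun p =>
    if hp : ∃ w ∈ Metric.ball y₀ (ε / 2), torusMk Λ w = p then hp.choose i else 0
  have hh : ∀ w ∈ Metric.ball y₀ (ε / 2), h (torusMk Λ w) = w i := by
    intro w hw
    have hp : ∃ w' ∈ Metric.ball y₀ (ε / 2), torusMk Λ w' = torusMk Λ w := ⟨w, hw, rfl⟩
    have h1 : h (torusMk Λ w) = hp.choose i := dif_pos hp
    obtain ⟨h2, h3⟩ := hp.choose_spec
    rw [h1]
    have h4 := hΛ _ (torusMk_eq_iff.1 h3) (by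
      rw [← dist_eq_norm]
      calc _ ≤ _ := dist_triangle_right _ _ y₀
        _ < ε / 2 + ε / 2 := add_lt_add h2 hw
        _ = ε := add_halves ε)
    rw [sub_eq_zero.1 h4]
  refine ⟨h, fun z hz => ?_, ?_⟩
  · have hl := torusMk_eq_iff.1 hz
    have h1 : AnalyticAt ℂ (fun z' : C3 => (z' - (z - y₀)) i) z :=
      ((ContinuousLinearMap.proj (R := ℂ) (φ := fun _ : Fin 3 => ℂ) i).analyticAt _).comp
        (analyticAt_id.sub analyticAt_const)
    refine h1.congr ?_
    have h2 : Tendsto (fun z' : C3 => z' - (z - y₀)) (𝓝 z) (𝓝 y₀) := by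
      have : ContinuousAt (fun z' : C3 => z' - (z - y₀)) z := by fun_prop
      simpa [ContinuousAt] using this
    filter_upwards [h2 (Metric.ball_mem_nhds y₀ (half_pos hε))] with z' hz'
    rw [← hh (z' - (z - y₀)) hz', Function.comp_apply]
    congr 1
    exact torusMk_eq_iff.2 (by simpa using Λ.neg_mem hl)
  · filter_upwards [Metric.ball_mem_nhds y₀ (half_pos hε)] with w hw using hh w hw

variable [IsZLattice ℝ Λ]

/-- A holomorphic self-map of a complex torus is induced by an affine map. -/
lemma exists_affine_lift {f : C3 ⧸ Λ → C3 ⧸ Λ} (hf : ∀ p, HolMapAt (torusMk Λ) (torusMk Λ) f p) :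
    ∃ (A : C3 →L[ℂ] C3) (b : C3), ∀ z, f (torusMk Λ z) = torusMk Λ (A z + b) := by
  have hfc : Continuous f := continuous_iff_continuousAt.2 fun p => (hf p).1
  obtain ⟨y, hy⟩ := torusMk_surjective (Λ := Λ) (f (torusMk Λ 0))
  obtain ⟨F, ⟨-, hF⟩, -⟩ := isCoveringMap_torusMk.existsUnique_continuousMap_lifts
    (⟨f ∘ torusMk Λ, hfc.comp continuous_torusMk⟩ : C(C3, C3 ⧸ Λ)) 0 y hy
  have hF : ∀ z, torusMk Λ (F z) = f (torusMk Λ z) := fun z => congrFun hF z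
  have hFa : ∀ z, AnalyticAt ℂ F z := by
    intro z
    refine analyticAt_pi_iff.2 fun i => ?_
    obtain ⟨h, h1, h2⟩ := exists_local_coordinate (Λ := Λ) (F z) i
    have h3 := (hf (torusMk Λ z)).2 h (by rw [← hF]; exact h1) z rfl
    refine h3.congr ?_
    filter_upwards [F.continuous.continuousAt.eventually h2] with z' hz'
    rw [← hz']
    simp [hF]
  have hFd : Differentiable ℂ F := fun z => (hFa z).differentiableAt
  -- `F (z + l) - F z` is continuous with values in the lattice, hence independent of `z`. The
  -- derivative is therefore periodic, so bounded, and Liouville's theorem applies to it.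
  have hper : ∀ z l, l ∈ Λ → fderiv ℂ F (z + l) = fderiv ℂ F z := by
    intro z l hl
    have h1 : ∀ w, F (w + l) - F w = F (0 + l) - F 0 := fun w =>
      eq_of_continuous_of_mem_lattice (Λ := Λ) (D := fun w => F (w + l) - F w) (by fun_prop)
        (fun w => by rw [← torusMk_eq_iff, hF, hF, torusMk_add_of_mem hl]) w 0
    have h2 : (fun w => F (w + l)) = fun w => F w + (F (0 + l) - F 0) := by
      ext1 w
      rw [← h1 w, add_sub_cancel]
    rw [← fderiv_comp_add_right, h2, fderiv_add_const]
  have hdd : Differentiable ℂ (fderiv ℂ F) := fun z => (hFa z).fderiv.differentiableAt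
  have hbdd : Bornology.IsBounded (Set.range (fderiv ℂ F)) :=
    (IsZLattice.isCompact_range_of_periodic Λ _ hdd.continuous hper).isBounded
  have hconst : ∀ z, fderiv ℂ F z = fderiv ℂ F 0 := fun z => hdd.apply_eq_apply_of_bounded hbdd z 0
  refine ⟨fderiv ℂ F 0, F 0, fun z => ?_⟩
  have h1 : (fun z => F z - fderiv ℂ F 0 z) z = (fun z => F z - fderiv ℂ F 0 z) 0 := by
    refine is_const_of_fderiv_eq_zero (𝕜 := ℂ) (f := fun z => F z - fderiv ℂ F 0 z)
      (hFd.sub (fderiv ℂ F 0).differentiable) (fun w => ?_) z 0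
    rw [fderiv_fun_sub (hFd w) (by fun_prop), ContinuousLinearMap.fderiv, hconst, sub_self]
  rw [← hF]
  congr 1
  simp only [map_zero, sub_zero] at h1
  rw [← h1, add_sub_cancel]

end Torus

/-! ### Linear parts of the action and isolated fixed points -/

section Torus

variable {Λ : Submodule ℤ C3} {G : Type*} [Group G] [MulAction G (C3 ⧸ Λ)]

/-- The action of `G` on the torus is induced by affine maps with linear parts `ρ` and translation
parts `b`. -/
def IsAffineAction (Λ : Submodule ℤ C3) {G : Type*} [Group G] [MulAction G (C3 ⧸ Λ)]
    (ρ : G →* Module.End ℂ C3) (b : G → C3) : Prop :=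
  ∀ g z, g • torusMk Λ z = torusMk Λ (ρ g z + b g)

/-- The difference of the two lifts takes values in a discrete lattice, hence is constant. This
uniqueness makes the linear parts multiplicative in the group element. -/
lemma eq_of_torusMk_affine_eq [DiscreteTopology Λ] {A A' : C3 →ₗ[ℂ] C3} {b b' : C3}
    (h : ∀ z, torusMk Λ (A z + b) = torusMk Λ (A' z + b')) : A = A' := by
  refine LinearMap.ext fun z => ?_
  have hA := A.continuous_of_finiteDimensional
  have hA' := A'.continuous_of_finiteDimensional
  have := eq_of_continuous_of_mem_lattice (Λ := Λ) (D := fun z => A z + b - (A' z + b'))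
    (by fun_prop) (fun z => torusMk_eq_iff.1 (h z)) z 0
  simp only [map_zero, zero_add] at this
  have h2 : A z - A' z = 0 := by
    calc A z - A' z = (A z + b - (A' z + b')) - (b - b') := by abel
      _ = 0 := by rw [this, sub_self]
  exact sub_eq_zero.1 h2

lemma exists_isAffineAction [DiscreteTopology Λ] [IsZLattice ℝ Λ] (hhol : IsHolomorphicAction Λ G) :
    ∃ (ρ : G →* Module.End ℂ C3) (b : G → C3), IsAffineAction Λ ρ b := by
  choose A b hA using fun g => exists_affine_lift (hhol g)
  refine ⟨{ toFun := fun g => (A g : C3 →ₗ[ℂ] C3), map_one' := ?_, map_mul' := fun g h => ?_ }, b, hA⟩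
  · refine eq_of_torusMk_affine_eq (Λ := Λ) (b := b 1) (b' := 0) fun z => ?_
    rw [ContinuousLinearMap.coe_coe, ← hA, one_smul, Module.End.one_apply, add_zero]
  · refine eq_of_torusMk_affine_eq (Λ := Λ) (b := b (g * h)) (b' := A g (b h) + b g) fun z => ?_
    rw [ContinuousLinearMap.coe_coe, ← hA, mul_smul, hA, hA, map_add, add_assoc]
    rfl

namespace IsAffineAction

variable {ρ : G →* Module.End ℂ C3} {b : G → C3} (hρ : IsAffineAction Λ ρ b)
include hρ

lemma continuous_smul (g : G) : Continuous fun p : C3 ⧸ Λ => g • p := by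
  refine (isOpenMap_torusMk.isQuotientMap continuous_torusMk torusMk_surjective).continuous_iff.2 ?_
  have hA := (ρ g).continuous_of_finiteDimensional
  have : (fun p : C3 ⧸ Λ => g • p) ∘ torusMk Λ = fun z => torusMk Λ (ρ g z + b g) :=
    funext fun z => hρ g z
  rw [this]
  exact continuous_torusMk.comp (by fun_prop)

lemma map_mem_lattice (g : G) {l : C3} (hl : l ∈ Λ) : ρ g l ∈ Λ := by
  have h1 : torusMk Λ (ρ g l + b g) = torusMk Λ (ρ g 0 + b g) := by
    rw [← hρ, ← hρ, torusMk_eq_iff.2 (show l - 0 ∈ Λ by simpa using hl)]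
  simpa using torusMk_eq_iff.1 h1

lemma smul_torusMk_of_mem_stabilizer {z₀ : C3} {g : G}
    (hg : g ∈ MulAction.stabilizer G (torusMk Λ z₀)) (z : C3) :
    g • torusMk Λ z = torusMk Λ (z₀ + ρ g (z - z₀)) := by
  have h1 : torusMk Λ (ρ g z₀ + b g) = torusMk Λ z₀ := by rw [← hρ]; exact hg
  rw [hρ, torusMk_eq_iff]
  have h2 := torusMk_eq_iff.1 h1
  convert h2 using 1
  rw [map_sub]
  abel

/-- For `v ≠ 0` every point `z₀ + t v` would be fixed by `g`. For `t` in a short interval these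
points are distinct modulo `Λ`, contradicting finiteness of the fixed locus. -/
lemma eq_zero_of_fixed [DiscreteTopology Λ] (hfix : HasFiniteFixedLocus Λ G) {z₀ : C3} {g : G}
    (hg : g ∈ MulAction.stabilizer G (torusMk Λ z₀)) (hg1 : g ≠ 1) {v : C3} (hv : ρ g v = v) :
    v = 0 := by
  by_contra hne
  obtain ⟨ε, hε, hΛ⟩ := exists_forall_mem_lattice_eq_zero Λ
  have hv0 : 0 < ‖v‖ := norm_pos_iff.2 hne
  have hinf : (Set.Ioo (0 : ℝ) (ε / ‖v‖)).Infinite := Set.Ioo_infinite (by positivity)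
  refine hinf (Set.Finite.of_injOn (f := fun t : ℝ => torusMk Λ (z₀ + (t : ℂ) • v)) ?_ ?_ hfix)
  · intro t _ hbot
    have h1 : g ∈ MulAction.stabilizer G (torusMk Λ (z₀ + (t : ℂ) • v)) := by
      rw [MulAction.mem_stabilizer_iff, hρ.smul_torusMk_of_mem_stabilizer hg, add_sub_cancel_left,
        map_smul, hv]
    rw [hbot] at h1
    exact hg1 h1
  · intro t ht s hs hts
    have h1 := torusMk_eq_iff.1 hts
    have h2 : z₀ + (t : ℂ) • v - (z₀ + (s : ℂ) • v) = ((t - s : ℝ) : ℂ) • v := by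
      push_cast
      rw [sub_smul]
      abel
    rw [h2] at h1
    have h3 := hΛ _ h1 (by
      rw [norm_smul, Complex.norm_real, Real.norm_eq_abs]
      have : |t - s| < ε / ‖v‖ := abs_sub_lt_iff.2 ⟨by linarith [ht.2, hs.1], by linarith [hs.2, ht.1]⟩
      exact (lt_div_iff₀ hv0).1 this)
    have h4 := (smul_eq_zero.1 h3).resolve_right hne
    have h5 : t - s = 0 := by exact_mod_cast h4
    linarith

end IsAffineAction

end Torus

/-! ### Integrality of characteristic polynomials -/

section Integrality

open Polynomial

/-- At a real point, the real determinant of a complex linear map is the squared absolute value of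
its complex determinant. Agreement at infinitely many points gives the polynomial identity. -/
lemma charpoly_restrictScalars_map_ofReal {V : Type*} [AddCommGroup V] [Module ℂ V]
    [Module.Finite ℂ V] [Module.Finite ℝ V] (f : V →ₗ[ℂ] V) :
    (f.restrictScalars ℝ).charpoly.map (algebraMap ℝ ℂ) =
      f.charpoly * f.charpoly.map (starRingEnd ℂ) := by
  refine Polynomial.eq_of_infinite_eval_eq _ _ (Set.Infinite.mono (s := Set.range ((↑) : ℝ → ℂ)) ?_
    (Set.infinite_range_of_injective Complex.ofReal_injective))
  rintro _ ⟨x, rfl⟩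
  have h1 : algebraMap ℝ (Module.End ℝ V) x - f.restrictScalars ℝ =
      (algebraMap ℂ (Module.End ℂ V) (x : ℂ) - f).restrictScalars ℝ := by
    ext v
    simp
  have h2 : (f.restrictScalars ℝ).charpoly.eval x = Complex.normSq (f.charpoly.eval (x : ℂ)) := by
    rw [LinearMap.eval_charpoly, LinearMap.eval_charpoly, h1, LinearMap.det_restrictScalars,
      Algebra.norm_complex_apply]
  have h3 : (f.charpoly.map (starRingEnd ℂ)).eval (x : ℂ) =
      starRingEnd ℂ (f.charpoly.eval (x : ℂ)) := by
    conv_lhs => rw [← Complex.conj_ofReal x]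
    rw [eval_map, eval₂_hom]
  show eval (algebraMap ℝ ℂ x) _ = _
  rw [eval_map_apply, h2, eval_mul, h3, Complex.mul_conj]
  rfl

/-- A `ℤ`-basis of the lattice is a real basis of the space, and in it `f` has an integral matrix.
-/
lemma exists_int_charpoly {E : Type*} [NormedAddCommGroup E] [NormedSpace ℂ E]
    [FiniteDimensional ℂ E] (L : Submodule ℤ E) [DiscreteTopology L] [IsZLattice ℝ L]
    (f : E →ₗ[ℂ] E) (hf : ∀ l ∈ L, f l ∈ L) :
    ∃ P : ℤ[X], P.map (Int.castRingHom ℂ) = f.charpoly * f.charpoly.map (starRingEnd ℂ) := by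
  have : FiniteDimensional ℝ E := FiniteDimensional.complexToReal E
  have : ProperSpace E := FiniteDimensional.proper ℝ E
  have : Module.Finite ℤ L := ZLattice.module_finite ℝ L
  have : Module.Free ℤ L := ZLattice.module_free ℝ L
  let bL := Module.Free.chooseBasis ℤ L
  let fL : L →ₗ[ℤ] L := (f.restrictScalars ℤ).restrict hf
  let b := bL.ofZLatticeBasis ℝ L
  refine ⟨fL.charpoly, ?_⟩
  have h1 : LinearMap.toMatrix b b (f.restrictScalars ℝ) =
      (LinearMap.toMatrix bL bL fL).map (Int.castRingHom ℝ) := by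
    ext i j
    rw [LinearMap.toMatrix_apply, Matrix.map_apply, LinearMap.toMatrix_apply]
    have : (f.restrictScalars ℝ) (b j) = (fL (bL j) : E) := by
      rw [Module.Basis.ofZLatticeBasis_apply]
      rfl
    rw [this]
    exact bL.ofZLatticeBasis_repr_apply ℝ L _ i
  have h2 : (f.restrictScalars ℝ).charpoly = fL.charpoly.map (Int.castRingHom ℝ) := by
    rw [← LinearMap.charpoly_toMatrix _ b, h1, Matrix.charpoly_map, LinearMap.charpoly_toMatrix]
  rw [← charpoly_restrictScalars_map_ofReal, h2, Polynomial.map_map]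
  congr 1

end Integrality

lemma IsAffineAction.isFreeIntegralRep {Λ : Submodule ℤ C3} [DiscreteTopology Λ] [IsZLattice ℝ Λ]
    {G : Type*} [Group G] [MulAction G (C3 ⧸ Λ)] {ρ : G →* Module.End ℂ C3} {b : G → C3}
    (hρ : IsAffineAction Λ ρ b) (hfix : HasFiniteFixedLocus Λ G) (z₀ : C3) :
    IsFreeIntegralRep (ρ.comp (MulAction.stabilizer G (torusMk Λ z₀)).subtype) where
  free h hh _ hv := hρ.eq_zero_of_fixed hfix h.2 (fun h1 => hh (Subtype.ext h1)) hv
  integral h := exists_int_charpoly Λ _ fun _ hl => hρ.map_mem_lattice h.1 hl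

/-! ### Biholomorphic germs of quotients -/

section Germs

variable {X Y : Type*}

/-- The local deck transformations of `q` act transitively on its fibres. -/
def IsDeckTransitive (q : C3 → X) : Prop :=
  ∀ z w, q z = q w → ∃ γ : C3 → C3, AnalyticAt ℂ γ w ∧ γ w = z ∧ ∀ x, q (γ x) = q x

lemma holFunAt_comp_iff {q : C3 → X} {Φ Ψ : C3 → C3} (hΦ : ∀ x, AnalyticAt ℂ Φ x)
    (hΨ : ∀ x, AnalyticAt ℂ Ψ x) (hΦΨ : ∀ x, Φ (Ψ x) = x) (x : X)
    (h : X → ℂ) : HolFunAt (q ∘ Φ) x h ↔ HolFunAt q x h := by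
  refine ⟨fun hh z hz => ?_, fun hh z hz => ?_⟩
  · have h1 := hh (Ψ z) (by rw [Function.comp_apply, hΦΨ, hz])
    have h2 := h1.comp (hΨ z)
    have h3 : (h ∘ q ∘ Φ) ∘ Ψ = h ∘ q := funext fun y => by simp [hΦΨ]
    rwa [h3] at h2
  · exact AnalyticAt.comp (g := h ∘ q) (hh (Φ z) hz) (hΦ z)

open Classical in
lemma exists_induced_map {p : C3 → X} {q : C3 → Y} {U : Set C3}
    (hpq : ∀ x ∈ U, ∀ y ∈ U, p x = p y → q x = q y) : ∃ F : X → Y, ∀ u ∈ U, F (p u) = q u := by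
  refine ⟨fun x => if hx : ∃ u ∈ U, p u = x then q hx.choose else q 0, fun u hu => ?_⟩
  have hx : ∃ u' ∈ U, p u' = p u := ⟨u, hu, rfl⟩
  exact (dif_pos hx).trans (hpq _ hx.choose_spec.1 _ hu hx.choose_spec.2)

variable [TopologicalSpace X] [TopologicalSpace Y]

/-- Holomorphy must be tested at every preimage of `p u`, not only at those in `U`; a local deck
transformation carries any such preimage to `u`. -/
lemma holMapAt_of_local {p : C3 → X} {q : C3 → Y} (hpo : IsOpenMap p) (hqc : Continuous q)
    (hdeck : IsDeckTransitive p) {U : Set C3} (hU : IsOpen U) {F : X → Y}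
    (hF : ∀ u ∈ U, F (p u) = q u) {u : C3} (hu : u ∈ U) : HolMapAt p q F (p u) := by
  refine ⟨fun N hN => ?_, fun h hh z hz => ?_⟩
  · rw [hF u hu] at hN
    have h1 : q ⁻¹' N ∩ U ∈ 𝓝 u := inter_mem (hqc.continuousAt hN) (hU.mem_nhds hu)
    refine mem_map.2 (mem_of_superset (hpo.image_mem_nhds h1) ?_)
    rintro _ ⟨v, ⟨hv1, hv2⟩, rfl⟩
    simpa [hF v hv2] using hv1
  · obtain ⟨γ, hγ, rfl, hpγ⟩ := hdeck u z hz.symm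
    have h1 : AnalyticAt ℂ (h ∘ q) (γ z) := hh (γ z) (hF _ hu).symm
    refine (h1.comp hγ).congr ?_
    filter_upwards [hγ.continuousAt.preimage_mem_nhds (hU.mem_nhds hu)] with x hx
    simp only [Function.comp_apply]
    rw [← hF _ hx, hpγ]

lemma germBiholomorphic_of_local_aux {p : C3 → X} {q : C3 → Y} (hpc : Continuous p)
    (hpo : IsOpenMap p) (hp : IsDeckTransitive p) (hqc : Continuous q) (hqo : IsOpenMap q)
    (hq : IsDeckTransitive q) {U : Set C3} (hU : IsOpen U) (h0 : 0 ∈ U)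
    (hpq : ∀ x ∈ U, ∀ y ∈ U, p x = p y ↔ q x = q y) : GermBiholomorphic p (p 0) q (q 0) := by
  obtain ⟨F, hF⟩ := exists_induced_map fun x hx y hy => (hpq x hx y hy).1
  obtain ⟨F', hF'⟩ := exists_induced_map fun x hx y hy => (hpq x hx y hy).2
  have h1 : ∀ x ∈ p '' U, HolMapAt p q F x := by
    rintro _ ⟨u, hu, rfl⟩
    exact holMapAt_of_local hpo hqc hp hU hF hu
  have h2 : ∀ y ∈ q '' U, HolMapAt q p F' y := by
    rintro _ ⟨u, hu, rfl⟩
    exact holMapAt_of_local hqo hpc hq hU hF' hu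
  refine ⟨
    { toFun := F
      invFun := F'
      source := p '' U
      target := q '' U
      map_source' := ?_
      map_target' := ?_
      left_inv' := ?_
      right_inv' := ?_
      open_source := hpo U hU
      open_target := hqo U hU
      continuousOn_toFun := fun x hx => (h1 x hx).1.continuousWithinAt
      continuousOn_invFun := fun y hy => (h2 y hy).1.continuousWithinAt },
    ⟨0, h0, rfl⟩, hF 0 h0, h1, h2⟩
  · rintro _ ⟨u, hu, rfl⟩
    exact ⟨u, hu, (hF u hu).symm⟩
  · rintro _ ⟨u, hu, rfl⟩
    exact ⟨u, hu, (hF' u hu).symm⟩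
  · rintro _ ⟨u, hu, rfl⟩
    rw [hF u hu, hF' u hu]
  · rintro _ ⟨u, hu, rfl⟩
    rw [hF' u hu, hF u hu]

/-- Two quotients of `ℂ³` whose fibres agree locally, in suitable affine coordinates, have
biholomorphic germs. -/
lemma germBiholomorphic_of_local {p : C3 → X} {q : C3 → Y} (hpc : Continuous p)
    (hpo : IsOpenMap p) (hp : IsDeckTransitive p) (hqc : Continuous q) (hqo : IsOpenMap q)
    (hq : IsDeckTransitive q) (z₀ : C3) (L : C3 ≃L[ℂ] C3) {U : Set C3} (hU : IsOpen U)
    (h0 : 0 ∈ U) (hpq : ∀ x ∈ U, ∀ y ∈ U, p (z₀ + L x) = p (z₀ + L y) ↔ q x = q y) :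
    GermBiholomorphic p (p z₀) q (q 0) := by
  let Φ : C3 → C3 := fun x => z₀ + L x
  let Ψ : C3 → C3 := fun x => L.symm (x - z₀)
  have hΦ : ∀ x, AnalyticAt ℂ Φ x := fun x =>
    analyticAt_const.add ((L : C3 →L[ℂ] C3).analyticAt x)
  have hΨ : ∀ x, AnalyticAt ℂ Ψ x := fun x =>
    ((L.symm : C3 →L[ℂ] C3).analyticAt _).comp (analyticAt_id.sub analyticAt_const)
  have hΦΨ : ∀ x, Φ (Ψ x) = x := fun x => by simp [Φ, Ψ]
  have hΨΦ : ∀ x, Ψ (Φ x) = x := fun x => by simp [Φ, Ψ]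
  have hΦo : IsOpenMap Φ := (Homeomorph.addLeft z₀).isOpenMap.comp L.toHomeomorph.isOpenMap
  have hdeck : IsDeckTransitive (p ∘ Φ) := by
    intro z w hzw
    obtain ⟨γ, h1, h2, h3⟩ := hp _ _ hzw
    refine ⟨fun x => Ψ (γ (Φ x)), ?_, (congrArg Ψ h2).trans (hΨΦ z), fun x => ?_⟩
    · exact (hΨ _).comp (h1.comp (hΦ w))
    · rw [Function.comp_apply, hΦΨ, h3]
      rfl
  obtain ⟨e, h1, h2, h3, h4⟩ := germBiholomorphic_of_local_aux (p := p ∘ Φ) (hpc.comp (by fun_prop))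
    (hpo.comp hΦo) hdeck hqc hqo hq hU h0 hpq
  have hp0 : (p ∘ Φ) 0 = p z₀ := by simp [Φ]
  rw [hp0] at h1 h2
  refine ⟨e, h1, h2, fun x hx => ⟨(h3 x hx).1, fun h hh => ?_⟩,
    fun y hy => ⟨(h4 y hy).1, fun h hh => ?_⟩⟩
  · exact (holFunAt_comp_iff hΦ hΨ hΦΨ _ _).1 ((h3 x hx).2 h hh)
  · exact (h4 y hy).2 h ((holFunAt_comp_iff hΦ hΨ hΦΨ _ _).2 hh)

lemma isDeckTransitive_id : IsDeckTransitive (id : C3 → C3) :=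
  fun _ _ h => ⟨id, analyticAt_id, h.symm, fun _ => rfl⟩

end Germs

section Cyclic

variable {d : ℕ} {a : Fin 3 → ℕ}

lemma cyclicMk_eq_iff {z w : C3} : cyclicMk d a z = cyclicMk d a w ↔
    ∃ ζ ∈ rootsOfUnity d ℂ, ∀ i, w i = (ζ : ℂ) ^ a i * z i :=
  Quotient.eq (r := cyclicSetoid d a)

lemma continuous_cyclicMk : Continuous (cyclicMk d a) := continuous_quotient_mk'

lemma isOpenMap_cyclicMk : IsOpenMap (cyclicMk d a) := by
  intro U hU
  have : cyclicMk d a ⁻¹' (cyclicMk d a '' U) =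
      ⋃ ζ ∈ rootsOfUnity d ℂ, (fun z : C3 => (fun i => (ζ : ℂ) ^ a i * z i : C3)) ⁻¹' U := by
    ext z
    simp only [Set.mem_preimage, Set.mem_image, Set.mem_iUnion, exists_prop]
    constructor
    · rintro ⟨u, hu, huz⟩
      obtain ⟨ζ, hζ, h⟩ := cyclicMk_eq_iff.1 huz.symm
      exact ⟨ζ, hζ, by rwa [← funext h]⟩
    · rintro ⟨ζ, hζ, h⟩
      exact ⟨_, h, (cyclicMk_eq_iff.2 ⟨ζ, hζ, fun _ => rfl⟩).symm⟩
  refine isOpen_coinduced.2 ?_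
  change IsOpen (cyclicMk d a ⁻¹' (cyclicMk d a '' U))
  rw [this]
  exact isOpen_biUnion fun ζ _ => hU.preimage (by fun_prop)

lemma isDeckTransitive_cyclicMk : IsDeckTransitive (cyclicMk d a) := by
  intro z w h
  obtain ⟨ζ, hζ, h⟩ := cyclicMk_eq_iff.1 h.symm
  refine ⟨fun x i => (ζ : ℂ) ^ a i * x i, ?_, (funext h).symm, fun x =>
    (cyclicMk_eq_iff.2 ⟨ζ, hζ, fun _ => rfl⟩).symm⟩
  exact analyticAt_pi_iff.2 fun i => analyticAt_const.mul
    ((ContinuousLinearMap.proj (R := ℂ) (φ := fun _ : Fin 3 => ℂ) i).analyticAt _)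

end Cyclic

/-! ### The local structure of quotients of tori -/

namespace IsAffineAction

variable {Λ : Submodule ℤ C3} {G : Type*} [Group G] [MulAction G (C3 ⧸ Λ)]
  {ρ : G →* Module.End ℂ C3} {b : G → C3}

lemma torusQuotientMk_eq_iff {z w : C3} :
    torusQuotientMk Λ G z = torusQuotientMk Λ G w ↔ ∃ g : G, g • torusMk Λ w = torusMk Λ z :=
  Quotient.eq (r := MulAction.orbitRel G (C3 ⧸ Λ))

lemma continuous_torusQuotientMk : Continuous (torusQuotientMk Λ G) :=
  continuous_quotient_mk'.comp continuous_torusMk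

variable (hρ : IsAffineAction Λ ρ b)
include hρ

lemma isOpenMap_orbitMk : IsOpenMap (orbitMk Λ G) := by
  have : ContinuousConstSMul G (C3 ⧸ Λ) := ⟨hρ.continuous_smul⟩
  exact isOpenMap_quotient_mk'_mul

lemma isOpenMap_torusQuotientMk : IsOpenMap (torusQuotientMk Λ G) :=
  hρ.isOpenMap_orbitMk.comp isOpenMap_torusMk

lemma exists_affine_deck {z w : C3} (h : torusQuotientMk Λ G z = torusQuotientMk Λ G w) :
    ∃ (g : G) (c : C3), ρ g w + c = z ∧
      ∀ x, torusQuotientMk Λ G (ρ g x + c) = torusQuotientMk Λ G x := by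
  obtain ⟨g, hg⟩ := torusQuotientMk_eq_iff.1 h
  rw [hρ, torusMk_eq_iff] at hg
  refine ⟨g, z - ρ g w, by abel, fun x => torusQuotientMk_eq_iff.2 ⟨g, ?_⟩⟩
  rw [hρ, torusMk_eq_iff]
  convert hg using 1
  abel

lemma isDeckTransitive : IsDeckTransitive (torusQuotientMk Λ G) := by
  intro z w h
  obtain ⟨g, c, h1, h2⟩ := hρ.exists_affine_deck h
  exact ⟨fun x => ρ g x + c,
    ((LinearMap.toContinuousLinearMap (ρ g)).analyticAt w).add analyticAt_const, h1, h2⟩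

lemma torusQuotientMk_eq_of_stabilizer {z₀ : C3} {g : G}
    (hg : g ∈ MulAction.stabilizer G (torusMk Λ z₀)) (x : C3) :
    torusQuotientMk Λ G (z₀ + ρ g x) = torusQuotientMk Λ G (z₀ + x) :=
  torusQuotientMk_eq_iff.2 ⟨g, by
    rw [hρ.smul_torusMk_of_mem_stabilizer hg, add_sub_cancel_left]⟩

/-- Near `z₀`, points are only identified by elements of the stabilizer. -/
lemma exists_ball_smul_eq [Finite G] [DiscreteTopology Λ] (z₀ : C3) :
    ∃ ε > 0, ∀ x y : C3, ‖x‖ < ε → ‖y‖ < ε →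
      ∀ g : G, g • torusMk Λ (z₀ + y) = torusMk Λ (z₀ + x) →
      g ∈ MulAction.stabilizer G (torusMk Λ z₀) ∧ x = ρ g y := by
  obtain ⟨δ, hδ, hΛ⟩ := exists_forall_mem_lattice_eq_zero Λ
  have h1 : ∀ g : G, ∀ᶠ p : C3 × C3 in 𝓝 0, g • torusMk Λ (z₀ + p.2) = torusMk Λ (z₀ + p.1) →
      g ∈ MulAction.stabilizer G (torusMk Λ z₀) ∧ p.1 = ρ g p.2 := by
    intro g
    -- A stabilizing `g` leaves only a small lattice vector as discrepancy, which is zero by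
    -- discreteness. Any other `g` moves the base point to a different point, and the Hausdorff
    -- property keeps nearby points apart.
    by_cases hg : g ∈ MulAction.stabilizer G (torusMk Λ z₀)
    · have hA := (ρ g).continuous_of_finiteDimensional
      have h2 : Continuous fun p : C3 × C3 => ‖p.1 - ρ g p.2‖ := by fun_prop
      have h3 : ∀ᶠ p : C3 × C3 in 𝓝 0, ‖p.1 - ρ g p.2‖ < δ :=
        h2.continuousAt.eventually_lt_const (by simpa using hδ)
      filter_upwards [h3] with p hp heq
      refine ⟨hg, ?_⟩
      rw [hρ.smul_torusMk_of_mem_stabilizer hg, add_sub_cancel_left] at heq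
      have h4 := torusMk_eq_iff.1 heq.symm
      rw [add_sub_add_left_eq_sub] at h4
      exact sub_eq_zero.1 (hΛ _ h4 hp)
    · have hc1 : Continuous fun p : C3 × C3 => g • torusMk Λ (z₀ + p.2) :=
        (hρ.continuous_smul g).comp (continuous_torusMk.comp (by fun_prop))
      have hc2 : Continuous fun p : C3 × C3 => torusMk Λ (z₀ + p.1) :=
        continuous_torusMk.comp (by fun_prop)
      have h3 := (isOpen_ne_fun hc1 hc2).mem_nhds (x := 0) (by
        simpa using hg)
      filter_upwards [h3] with p hp heq
      exact absurd heq hp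
  obtain ⟨ε, hε, h2⟩ := Metric.eventually_nhds_iff_ball.1 (eventually_all.2 h1)
  exact ⟨ε, hε, fun x y hx hy g hg =>
    h2 (x, y) (by rw [mem_ball_zero_iff, Prod.norm_def]; exact max_lt hx hy) g hg⟩

/-- Near `z₀`, the fibres of the quotient map are the orbits of the stabilizer. -/
lemma exists_ball_stabilizer [Finite G] [DiscreteTopology Λ] (z₀ : C3) :
    ∃ ε > 0, ∀ x y : C3, ‖x‖ < ε → ‖y‖ < ε →
      torusQuotientMk Λ G (z₀ + x) = torusQuotientMk Λ G (z₀ + y) →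
      ∃ g ∈ MulAction.stabilizer G (torusMk Λ z₀), x = ρ g y := by
  obtain ⟨ε, hε, h⟩ := hρ.exists_ball_smul_eq z₀
  refine ⟨ε, hε, fun x y hx hy hxy => ?_⟩
  obtain ⟨g, hg⟩ := torusQuotientMk_eq_iff.1 hxy
  exact ⟨g, h x y hx hy g hg⟩

lemma smoothPoint_of_stabilizer_eq_bot [Finite G] [DiscreteTopology Λ] {p : C3 ⧸ Λ}
    (hp : MulAction.stabilizer G p = ⊥) : SmoothPoint (torusQuotientMk Λ G) (orbitMk Λ G p) := by
  obtain ⟨z₀, rfl⟩ := torusMk_surjective p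
  obtain ⟨ε, hε, h⟩ := hρ.exists_ball_stabilizer z₀
  refine germBiholomorphic_of_local continuous_torusQuotientMk hρ.isOpenMap_torusQuotientMk
    hρ.isDeckTransitive continuous_id IsOpenMap.id isDeckTransitive_id z₀ (.refl ℂ C3)
    Metric.isOpen_ball (Metric.mem_ball_self hε) fun x hx y hy => ⟨fun hxy => ?_, fun hxy => ?_⟩
  · obtain ⟨g, hg, hgx⟩ := h x y (by simpa using hx) (by simpa using hy) hxy
    rw [hp, Subgroup.mem_bot] at hg
    rw [hgx, hg, map_one]
    rfl
  · rw [show x = y from hxy]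

/-- Only the finite image of the fixed locus can be singular. Fibres of the quotient map are finite,
so points are closed and the part of this image other than `x` can be avoided. -/
lemma eventually_smoothPoint [Finite G] [DiscreteTopology Λ] (hfix : HasFiniteFixedLocus Λ G)
    (x : TorusQuotient Λ G) : ∀ᶠ y in 𝓝[≠] x, SmoothPoint (torusQuotientMk Λ G) y := by
  have hclosed : ∀ y : TorusQuotient Λ G, IsClosed {y} := by
    intro y
    obtain ⟨p, rfl⟩ := Quotient.exists_rep y
    refine ((isQuotientMap_quotient_mk' (s := MulAction.orbitRel G (C3 ⧸ Λ))).isClosed_preimage).1 ?_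
    have : Set.Finite (orbitMk Λ G ⁻¹' {orbitMk Λ G p}) := by
      refine (Set.finite_range fun g : G => g • p).subset fun p' hp' => ?_
      exact Quotient.exact hp'
    exact this.isClosed
  have hfin : (orbitMk Λ G '' {p | MulAction.stabilizer G p ≠ ⊥} \ {x}).Finite :=
    (hfix.image _).subset Set.sdiff_subset
  have hS : IsClosed (orbitMk Λ G '' {p | MulAction.stabilizer G p ≠ ⊥} \ {x}) := by
    rw [← Set.biUnion_of_singleton (orbitMk Λ G '' {p | MulAction.stabilizer G p ≠ ⊥} \ {x})]
    exact hfin.isClosed_biUnion fun y _ => hclosed y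
  have h1 := hS.isOpen_compl.mem_nhds (x := x) (fun h => h.2 rfl)
  filter_upwards [mem_nhdsWithin_of_mem_nhds h1, self_mem_nhdsWithin] with y hy hyx
  obtain ⟨p, rfl⟩ := Quotient.exists_rep y
  refine hρ.smoothPoint_of_stabilizer_eq_bot ?_
  by_contra hne
  exact hy ⟨⟨p, hne, rfl⟩, hyx⟩

lemma isCyclicQuotientPoint [Finite G] [DiscreteTopology Λ] {z₀ : C3} {d : ℕ} {a : Fin 3 → ℕ}
    (hd : 0 < d) {g : MulAction.stabilizer G (torusMk Λ z₀)} (hg : ∀ h, h ∈ Submonoid.powers g)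
    (L : C3 ≃L[ℂ] C3) {ζ : ℂ} (hζ : IsPrimitiveRoot ζ d)
    (hL : ∀ x, ρ g (L x) = L fun i => ζ ^ a i * x i) :
    IsCyclicQuotientPoint (torusQuotientMk Λ G) (orbitMk Λ G (torusMk Λ z₀)) d a := by
  obtain ⟨ε, hε, h⟩ := hρ.exists_ball_stabilizer z₀
  have hpow : ∀ (m : ℕ) (x : C3), ρ (g ^ m : MulAction.stabilizer G (torusMk Λ z₀)) (L x) =
      L fun i => (ζ ^ m) ^ a i * x i := by
    intro m
    induction m with
    | zero => simp
    | succ m ih =>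
      intro x
      rw [pow_succ, Subgroup.coe_mul, map_mul, Module.End.mul_apply, hL, ih]
      congr 1
      ext i
      rw [pow_succ, mul_pow, mul_assoc]
  refine germBiholomorphic_of_local continuous_torusQuotientMk hρ.isOpenMap_torusQuotientMk
    hρ.isDeckTransitive continuous_cyclicMk isOpenMap_cyclicMk isDeckTransitive_cyclicMk z₀ L
    (U := L ⁻¹' Metric.ball 0 ε) (Metric.isOpen_ball.preimage L.continuous) (by simpa using hε)
    fun x hx y hy => ⟨fun hxy => ?_, fun hxy => ?_⟩
  · obtain ⟨k, hk, hkx⟩ := h (L x) (L y) (by simpa using hx) (by simpa using hy) hxy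
    obtain ⟨m, hm⟩ := hg ⟨k, hk⟩
    have h1 := hpow m y
    rw [show g ^ m = ⟨k, hk⟩ from hm, ← hkx] at h1
    have h2 := L.injective h1
    refine (cyclicMk_eq_iff.2 ⟨(hζ.isUnit hd.ne').unit ^ m, ?_, fun i => ?_⟩).symm
    · refine pow_mem ?_ m
      rw [mem_rootsOfUnity']
      exact hζ.pow_eq_one
    · rw [h2]
      simp
  · obtain ⟨ξ, hξ, hξx⟩ := cyclicMk_eq_iff.1 hxy.symm
    have : NeZero d := ⟨hd.ne'⟩
    obtain ⟨m, -, hm⟩ := hζ.eq_pow_of_pow_eq_one ((mem_rootsOfUnity' d ξ).1 hξ)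
    have h1 : L x = ρ (g ^ m : MulAction.stabilizer G (torusMk Λ z₀)) (L y) := by
      rw [hpow, hm]
      congr 1
      exact funext hξx
    rw [h1]
    exact hρ.torusQuotientMk_eq_of_stabilizer (g ^ m).2 _

end IsAffineAction

/-! ### Monomial charts of weighted blow-ups -/

section MonomialChart

/-- The chart `(τ, s₁, s₂) ↦ (τ, τ ^ a s₁, τ ^ b s₂)` of a weighted blow-up; the first coordinate of
the argument `w` is not used. -/
def monomialChart (a b : ℕ) (τ : ℂ) (w : C3) : C3 := ![τ, τ ^ a * w 1, τ ^ b * w 2]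

variable {a b : ℕ}

lemma continuous_monomialChart : Continuous fun p : ℂ × C3 => monomialChart a b p.1 p.2 := by
  refine continuous_pi fun i => ?_
  fin_cases i
  · exact continuous_fst
  · show Continuous fun p : ℂ × C3 => p.1 ^ a * p.2 1
    fun_prop
  · show Continuous fun p : ℂ × C3 => p.1 ^ b * p.2 2
    fun_prop

lemma monomialChart_zero (ha : a ≠ 0) (hb : b ≠ 0) (w : C3) : monomialChart a b 0 w = 0 := by
  ext i
  fin_cases i <;> simp [monomialChart, ha, hb]

lemma analyticAt_apply (i : Fin 3) (w : C3) : AnalyticAt ℂ (fun w : C3 => w i) w :=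
  (ContinuousLinearMap.proj (R := ℂ) (φ := fun _ : Fin 3 => ℂ) i).analyticAt w

lemma analyticAt_monomialChart {r : ℂ → ℂ} {w : C3} (hr : AnalyticAt ℂ r (w 0)) :
    AnalyticAt ℂ (fun w : C3 => monomialChart a b (r (w 0)) w) w := by
  have h0 : AnalyticAt ℂ (fun w : C3 => r (w 0)) w :=
    AnalyticAt.fun_comp (g := r) hr (analyticAt_apply 0 w)
  refine analyticAt_pi_iff.2 fun i => ?_
  fin_cases i
  · exact h0
  · exact (h0.pow a).mul (analyticAt_apply 1 w)
  · exact (h0.pow b).mul (analyticAt_apply 2 w)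

/-- The Jacobian matrix is lower triangular, so the entries `k₁`, `k₂` below the diagonal need not
be known. -/
lemma det_fderiv_monomialChart {r : ℂ → ℂ} {r' : ℂ} {w : C3} (hr : HasDerivAt r r' (w 0)) :
    (fderiv ℂ (fun w : C3 => monomialChart a b (r (w 0)) w) w).det =
      r' * r (w 0) ^ a * r (w 0) ^ b := by
  let π : Fin 3 → C3 →L[ℂ] ℂ := fun i => ContinuousLinearMap.proj i
  have hπ : ∀ i, HasFDerivAt (fun w : C3 => w i) (π i) w := fun i => (π i).hasFDerivAt
  have h0 : HasFDerivAt (fun w : C3 => r (w 0)) (r' • π 0) w := hr.comp_hasFDerivAt w (hπ 0)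
  have hpow : ∀ (n : ℕ) (i : Fin 3), ∃ k : ℂ,
      HasFDerivAt (fun w : C3 => r (w 0) ^ n * w i) (k • π 0 + r (w 0) ^ n • π i) w := by
    intro n i
    have h1 : HasFDerivAt (fun w : C3 => r (w 0) ^ n) ((n * r (w 0) ^ (n - 1) * r') • π 0) w :=
      HasDerivAt.comp_hasFDerivAt (h₂ := fun t => r t ^ n) (f := fun w : C3 => w 0) w
        (hr.fun_pow n) (hπ 0)
    refine ⟨w i * (n * r (w 0) ^ (n - 1) * r'), ?_⟩
    refine (h1.mul (hπ i)).congr_fderiv ?_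
    rw [add_comm, smul_smul]
  obtain ⟨k₁, h1⟩ := hpow a 1
  obtain ⟨k₂, h2⟩ := hpow b 2
  have hF : HasFDerivAt (fun w : C3 => monomialChart a b (r (w 0)) w)
      (ContinuousLinearMap.pi ![r' • π 0, k₁ • π 0 + r (w 0) ^ a • π 1,
        k₂ • π 0 + r (w 0) ^ b • π 2]) w := by
    refine hasFDerivAt_pi'.2 fun i => ?_
    fin_cases i
    · exact h0
    · exact h1
    · exact h2
  rw [hF.fderiv, ContinuousLinearMap.det, ← LinearMap.det_toMatrix', Matrix.det_fin_three]
  simp [LinearMap.toMatrix'_apply, π]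

/-- Local branches of the `N`-th root. -/
lemma exists_local_root {N : ℕ} (hN : 0 < N) {τ₀ : ℂ} (hτ : τ₀ ≠ 0) :
    ∃ r : ℂ → ℂ, AnalyticAt ℂ r (τ₀ ^ N) ∧ r (τ₀ ^ N) = τ₀ ∧
      HasDerivAt r (τ₀ / (N * τ₀ ^ N)) (τ₀ ^ N) ∧ ∀ᶠ t in 𝓝 (τ₀ ^ N), r t ^ N = t := by
  have ht : τ₀ ^ N ≠ 0 := pow_ne_zero _ hτ
  have hN' : (N : ℂ) ≠ 0 := by exact_mod_cast hN.ne'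
  let r : ℂ → ℂ := fun t => τ₀ * Complex.exp (Complex.log (t / τ₀ ^ N) / N)
  have h1 : HasDerivAt (fun t : ℂ => t / τ₀ ^ N) (1 / τ₀ ^ N) (τ₀ ^ N) :=
    (hasDerivAt_id _).div_const _
  have hslit : τ₀ ^ N / τ₀ ^ N ∈ Complex.slitPlane := by
    rw [div_self ht]
    exact Complex.one_mem_slitPlane
  refine ⟨r, ?_, ?_, ?_, ?_⟩
  · refine analyticAt_const.mul (AnalyticAt.cexp' ?_)
    refine AnalyticAt.div (AnalyticAt.clog ?_ hslit) analyticAt_const hN'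
    exact analyticAt_id.div analyticAt_const ht
  · simp [r, div_self ht]
  · have h2 := (((h1.clog hslit).div_const (N : ℂ)).cexp).const_mul τ₀
    refine h2.congr_deriv ?_
    rw [div_self ht, Complex.log_one, zero_div, Complex.exp_zero]
    field_simp
  · filter_upwards [isOpen_ne.mem_nhds ht] with t ht'
    have h3 : Complex.exp (Complex.log (t / τ₀ ^ N) / N) ^ N = t / τ₀ ^ N := by
      rw [← Complex.exp_nat_mul, mul_div_cancel₀ _ hN', Complex.exp_log (div_ne_zero ht' ht)]
    simp only [r, mul_pow, h3]
    field_simp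

/-- `root` is an arbitrary choice of roots, possibly discontinuous elsewhere; at 0 the absolute
value alone gives continuity. -/
lemma tendsto_root_zero {N : ℕ} (hN : N ≠ 0) {root : ℂ → ℂ} (h : ∀ t, root t ^ N = t) :
    ContinuousAt root 0 := by
  have h0 : root 0 = 0 := by simpa [hN] using h 0
  refine Metric.continuousAt_iff.2 fun ε hε => ⟨ε ^ N, by positivity, fun {t} ht => ?_⟩
  rw [h0, dist_zero_right]
  rw [dist_zero_right, ← h t, norm_pow] at ht
  exact lt_of_pow_lt_pow_left₀ N hε.le ht

end MonomialChart

/-! ### Discrepancies of weighted blow-ups -/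

section Discrepancy

variable {X : Type*}

/-- Near `q z₀`, and in the coordinates `x ↦ z₀ + L x`, the map `q` is the quotient map by a finite
set `C` of diagonal matrices, and it is unramified off the origin. -/
structure IsDiagonalModel (q : C3 → X) (z₀ : C3) (L : C3 ≃L[ℂ] C3) (C : Set (Fin 3 → ℂ))
    (ε : ℝ) : Prop where
  pos : 0 < ε
  finite : C.Finite
  exists_of_eq : ∀ x y : C3, ‖x‖ < ε → ‖y‖ < ε → q (z₀ + L x) = q (z₀ + L y) →
    ∃ c ∈ C, ∀ i, x i = c i * y i
  eq_of_mem : ∀ c ∈ C, ∀ x : C3, q (z₀ + L fun i => c i * x i) = q (z₀ + L x)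
  mem_unramifiedLocus : ∀ x : C3, ‖x‖ < ε → x ≠ 0 → q (z₀ + L x) ∈ unramifiedLocus q

/-- A chart of a weighted blow-up of a quotient of `ℂ³`. -/
noncomputable def blowupChart (q : C3 → X) (z₀ : C3) (L : C3 ≃L[ℂ] C3) (a b : ℕ) (root : ℂ → ℂ) (w : C3) : X :=
  q (z₀ + L (monomialChart a b (root (w 0)) w))

lemma tendsto_monomialChart_root {a b N : ℕ} (hN : 0 < N) {root : ℂ → ℂ}
    (hroot : ∀ t, root t ^ N = t) (ha : a ≠ 0) (hb : b ≠ 0) (z₀ : C3) (L : C3 ≃L[ℂ] C3) {w : C3} (hw : w 0 = 0) :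
    Tendsto (fun w' : C3 => z₀ + L (monomialChart a b (root (w' 0)) w')) (𝓝 w) (𝓝 z₀) := by
  have h1 : ContinuousAt (fun w' : C3 => root (w' 0)) w :=
    ContinuousAt.comp (g := root) (by rw [hw]; exact tendsto_root_zero hN.ne' hroot)
      (continuous_apply 0).continuousAt
  have h2 : ContinuousAt (fun w' : C3 => monomialChart a b (root (w' 0)) w') w :=
    ContinuousAt.comp (f := fun w' : C3 => (root (w' 0), w'))
      (continuous_monomialChart (a := a) (b := b)).continuousAt (h1.prodMk continuousAt_id)
  have h3 : ContinuousAt (fun w' : C3 => z₀ + L (monomialChart a b (root (w' 0)) w')) w :=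
    continuousAt_const.add (L.continuous.continuousAt.comp h2)
  have h0 : root (w 0) = 0 := by rw [hw]; simpa [hN.ne'] using hroot 0
  rw [ContinuousAt, h0, monomialChart_zero ha hb, map_zero, add_zero] at h3
  exact h3

namespace IsDiagonalModel

variable {q : C3 → X} {z₀ : C3} {L : C3 ≃L[ℂ] C3} {C : Set (Fin 3 → ℂ)} {ε : ℝ}
  (h : IsDiagonalModel q z₀ L C ε) {a b N : ℕ} {ξ : ℂ}
include h

/-- Two `N`-th roots of the same number differ by a power of `ξ`, which acts on the chart through
the given element of `C`. The chart into `X` is thus independent of the choice of root. -/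
lemma monomialChart_congr (hN : 0 < N) (hξ : IsPrimitiveRoot ξ N) (hC : ![ξ, ξ ^ a, ξ ^ b] ∈ C)
    {τ τ' : ℂ} (hτ : τ ^ N = τ' ^ N) (w : C3) :
    q (z₀ + L (monomialChart a b τ w)) = q (z₀ + L (monomialChart a b τ' w)) := by
  have h1 : ∀ j : ℕ, q (z₀ + L (monomialChart a b (ξ ^ j * τ') w)) =
      q (z₀ + L (monomialChart a b τ' w)) := by
    intro j
    induction j with
    | zero => simp
    | succ j ih =>
      rw [← ih, ← h.eq_of_mem _ hC (monomialChart a b (ξ ^ j * τ') w)]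
      congr 3
      ext i
      fin_cases i
      · show ξ ^ (j + 1) * τ' = ξ * (ξ ^ j * τ')
        ring
      · show (ξ ^ (j + 1) * τ') ^ a * w 1 = ξ ^ a * ((ξ ^ j * τ') ^ a * w 1)
        ring
      · show (ξ ^ (j + 1) * τ') ^ b * w 2 = ξ ^ b * ((ξ ^ j * τ') ^ b * w 2)
        ring
  by_cases hτ' : τ' = 0
  · have : τ = 0 := by
      rw [hτ', zero_pow hN.ne'] at hτ
      exact pow_eq_zero_iff hN.ne' |>.1 hτ
    rw [this, hτ']
  · have : NeZero N := ⟨hN.ne'⟩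
    obtain ⟨j, -, hj⟩ := hξ.eq_pow_of_pow_eq_one (ξ := τ / τ') (by
      rw [div_pow, hτ, div_self (pow_ne_zero _ hτ')])
    rw [← h1 j, hj, div_mul_cancel₀ _ hτ']

variable (hN : 0 < N) (hξ : IsPrimitiveRoot ξ N) (hC : ![ξ, ξ ^ a, ξ ^ b] ∈ C)
  {root : ℂ → ℂ} (hroot : ∀ t, root t ^ N = t)
include hN hξ hC hroot

/-- Away from `w 0 = 0`, replace `root` by a holomorphic branch with the same value at `w 0`. By
`monomialChart_congr` this does not change the map to `X`, and its Jacobian can be computed. -/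
lemma exists_lift {w : C3} (hw : w 0 ≠ 0) : ∃ F : C3 → C3,
    IsLiftAt q (blowupChart q z₀ L a b root) F w ∧
      F w = z₀ + L (monomialChart a b (root (w 0)) w) ∧
      (fderiv ℂ F w).det = (L : C3 →L[ℂ] C3).det *
        (root (w 0) / (N * w 0) * root (w 0) ^ a * root (w 0) ^ b) := by
  have hτ : root (w 0) ≠ 0 := fun h0 => hw (by rw [← hroot (w 0), h0, zero_pow hN.ne'])
  obtain ⟨r, hra, hr0, hr', hrN⟩ := exists_local_root hN hτ
  rw [hroot] at hra hr0 hr' hrN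
  have hM := analyticAt_monomialChart (a := a) (b := b) hra
  refine ⟨fun w => z₀ + L (monomialChart a b (r (w 0)) w), ⟨?_, ?_⟩, by simp only [hr0], ?_⟩
  · exact analyticAt_const.add (((L : C3 →L[ℂ] C3).analyticAt _).comp hM)
  · have hc : ContinuousAt (fun w : C3 => w 0) w := (continuous_apply 0).continuousAt
    filter_upwards [hc.eventually hrN] with w' hw'
    exact h.monomialChart_congr hN hξ hC (by rw [hw', hroot]) w'
  · rw [fderiv_const_add]
    have h1 : fderiv ℂ (fun w => L (monomialChart a b (r (w 0)) w)) w =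
        (L : C3 →L[ℂ] C3).comp (fderiv ℂ (fun w => monomialChart a b (r (w 0)) w) w) :=
      fderiv_comp (g := L) w L.differentiableAt hM.differentiableAt |>.trans (by
        rw [ContinuousLinearEquiv.fderiv])
    have hdet := det_fderiv_monomialChart (a := a) (b := b) hr'
    rw [hr0] at hdet
    rw [h1, ← hdet]
    exact LinearMap.det_comp _ _

variable [TopologicalSpace X] (hq : Continuous q) (ha : a ≠ 0) (hb : b ≠ 0)

include hq ha hb

/-- Off `w 0 = 0` there is a holomorphic lift. The hyperplane itself is contracted to `q z₀`, and
there pulled-back functions are continuous, so they are analytic by Riemann extension. -/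
lemma holMapAt_blowupChart (w : C3) :
    HolMapAt (id : C3 → C3) q (blowupChart q z₀ L a b root) w := by
  have hlift : ∀ w : C3, w 0 ≠ 0 → ∀ g : X → ℂ,
      AnalyticAt ℂ (g ∘ q) (z₀ + L (monomialChart a b (root (w 0)) w)) →
      AnalyticAt ℂ (g ∘ blowupChart q z₀ L a b root) w := by
    intro w hw g hg
    obtain ⟨F, ⟨hFa, hFq⟩, hF, -⟩ := h.exists_lift hN hξ hC hroot hw
    rw [← hF] at hg
    refine (hg.comp hFa).congr ?_
    filter_upwards [hFq] with w' hw'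
    simp only [Function.comp_apply, hw']
  have hval : ∀ w : C3, w 0 = 0 → blowupChart q z₀ L a b root w = q z₀ := by
    intro w hw
    have h0 : root (w 0) = 0 := by rw [hw]; simpa [hN.ne'] using hroot 0
    rw [blowupChart, h0, monomialChart_zero ha hb, map_zero, add_zero]
  refine ⟨?_, fun g hg z hz => ?_⟩
  · by_cases hw : w 0 = 0
    · have h1 := tendsto_monomialChart_root hN hroot ha hb z₀ L hw
      rw [ContinuousAt, hval w hw]
      exact (hq.tendsto z₀).comp h1
    · obtain ⟨F, ⟨hFa, hFq⟩, hF, -⟩ := h.exists_lift hN hξ hC hroot hw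
      exact (hq.continuousAt.comp hFa.continuousAt).congr hFq
  · obtain rfl : z = w := hz
    show AnalyticAt ℂ (g ∘ blowupChart q z₀ L a b root) z
    by_cases hw : z 0 = 0
    · have hg0 : AnalyticAt ℂ (g ∘ q) z₀ := hg z₀ (hval z hw).symm
      have hev : ∀ᶠ w in 𝓝 z, AnalyticAt ℂ (g ∘ q) (z₀ + L (monomialChart a b (root (w 0)) w)) :=
        (tendsto_monomialChart_root hN hroot ha hb z₀ L hw).eventually hg0.eventually_analyticAt
      have hcont : ∀ᶠ w in 𝓝 z, ContinuousAt (g ∘ blowupChart q z₀ L a b root) w := by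
        filter_upwards [hev] with w hw'
        by_cases hw0 : w 0 = 0
        · have h1 := tendsto_monomialChart_root hN hroot ha hb z₀ L hw0
          have h2 := hg0.continuousAt.tendsto.comp h1
          rw [ContinuousAt, Function.comp_apply, hval w hw0]
          exact h2
        · exact (hlift w hw0 g hw').continuousAt
      have hana : ∀ᶠ w in 𝓝 z, w 0 ≠ 0 → AnalyticAt ℂ (g ∘ blowupChart q z₀ L a b root) w := by
        filter_upwards [hev] with w hw' hw0 using hlift w hw0 g hw'
      -- The extension theorem is stated on a product `ℂ × E`; `ι` overwrites the first coordinate,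
      -- and `w ↦ (w 0, w)` is a section of it.
      let ι : ℂ × C3 → C3 := fun p => ![p.1, p.2 1, p.2 2]
      have hιa : ∀ p, AnalyticAt ℂ ι p := by
        intro p
        refine analyticAt_pi_iff.2 fun i => ?_
        fin_cases i
        · exact analyticAt_fst
        · exact AnalyticAt.comp (g := fun w : C3 => w 1) (f := fun p : ℂ × C3 => p.2)
            (analyticAt_apply 1 _) analyticAt_snd
        · exact AnalyticAt.comp (g := fun w : C3 => w 2) (f := fun p : ℂ × C3 => p.2)
            (analyticAt_apply 2 _) analyticAt_snd
      have hι : ∀ w : C3, ι (w 0, w) = w := fun w => by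
        ext i
        fin_cases i <;> rfl
      have hι0 : ι (0, z) = z := by rw [← hw, hι]
      have hιt : Tendsto ι (𝓝 (0, z)) (𝓝 z) := by
        have := (hιa (0, z)).continuousAt.tendsto
        rwa [hι0] at this
      have hK : AnalyticAt ℂ ((g ∘ blowupChart q z₀ L a b root) ∘ ι) (0, z) := by
        refine analyticAt_of_continuous_of_analyticAt_off ?_ ?_
        · filter_upwards [hιt.eventually hcont] with p hp
          exact ContinuousAt.comp hp (hιa p).continuousAt
        · filter_upwards [hιt.eventually hana] with p hp hp0
          exact AnalyticAt.comp (hp hp0) (hιa p)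
      have h2 : AnalyticAt ℂ (fun w : C3 => (w 0, w)) z := (analyticAt_apply 0 z).prod analyticAt_id
      have h3 := AnalyticAt.comp (f := fun w : C3 => (w 0, w)) (by rw [hw]; exact hK) h2
      refine h3.congr (Eventually.of_forall fun w => ?_)
      simp only [Function.comp_apply, hι]
    · exact hlift z hw g (hg _ rfl)

end IsDiagonalModel

/-! ### Bimeromorphy of the chart and the age criterion -/

namespace IsDiagonalModel

variable {X : Type*} {q : C3 → X} {z₀ : C3} {L : C3 ≃L[ℂ] C3} {C : Set (Fin 3 → ℂ)} {ε : ℝ}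
  (h : IsDiagonalModel q z₀ L C ε) {a b N : ℕ} {ξ : ℂ}
include h

/-- If `c i ≠ c 0 ^ n`, the equation already fails at `(v, v)` and hence nearby; finiteness of `C`
makes the neighbourhood uniform. -/
lemma eventually_eq_pow (i : Fin 3) {n : ℕ} {v : C3} (hv : v i = 1) :
    ∀ᶠ p : C3 × C3 in 𝓝 (v, v), ∀ c ∈ C, c 0 ^ n * p.1 i = c i * p.2 i → c i = c 0 ^ n := by
  refine (Filter.eventually_all_finite h.finite).2 fun c _ => ?_
  by_cases hc : c i = c 0 ^ n
  · exact Eventually.of_forall fun _ _ => hc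
  · have h1 : Continuous fun p : C3 × C3 => c 0 ^ n * p.1 i := by fun_prop
    have h2 : Continuous fun p : C3 × C3 => c i * p.2 i := by fun_prop
    filter_upwards [(isOpen_ne_fun h1 h2).mem_nhds (x := (v, v)) (by
      simpa [hv] using fun h' : c 0 ^ n = c i => hc h'.symm)] with p hp hp'
    exact absurd hp' hp

variable [TopologicalSpace X] (hq : Continuous q) (hN : 0 < N) (hξ : IsPrimitiveRoot ξ N)
  (hC : ![ξ, ξ ^ a, ξ ^ b] ∈ C) (ha : a ≠ 0) (hb : b ≠ 0) {root : ℂ → ℂ}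
  (hroot : ∀ t, root t ^ N = t)
include hq hN hξ hC ha hb hroot

/-- Two points off `w 0 = 0` with the same image differ by some `c ∈ C` upstairs. Near `(0, 1, 1)`
this `c` must be `(c 0, c 0 ^ a, c 0 ^ b)`, and `hI` then gives equal `N`-th powers of the roots, so
equal points. -/
lemma exists_isBimeromorphicMorphism
    (hI : ∀ c ∈ C, c 1 = c 0 ^ a → c 2 = c 0 ^ b → c 0 ^ N = 1) :
    ∃ η > 0, IsBimeromorphicMorphism q (Metric.ball ![0, 1, 1] η) (blowupChart q z₀ L a b root) ∧
      ∀ w ∈ Metric.ball (![0, 1, 1] : C3) η, w 0 ≠ 0 →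
        blowupChart q z₀ L a b root w ∈ unramifiedLocus q := by
  set v : C3 := ![0, 1, 1]
  have e1 : ∀ᶠ w in 𝓝 v, ‖monomialChart a b (root (w 0)) w‖ < ε := by
    have := tendsto_monomialChart_root hN hroot ha hb 0 (.refl ℂ C3) (w := v) rfl
    have h2 := this.eventually (Metric.ball_mem_nhds 0 h.pos)
    filter_upwards [h2] with w hw
    simpa using hw
  obtain ⟨η₁, hη₁, h1⟩ := Metric.eventually_nhds_iff_ball.1 e1
  obtain ⟨η₂, hη₂, h2⟩ := Metric.eventually_nhds_iff_ball.1
    ((h.eventually_eq_pow 1 (n := a) (v := v) rfl).and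
      (h.eventually_eq_pow 2 (n := b) (v := v) rfl))
  have hr0 : ∀ w : C3, w 0 ≠ 0 → root (w 0) ≠ 0 := fun w hw h0 =>
    hw (by rw [← hroot (w 0), h0, zero_pow hN.ne'])
  have hunr : ∀ w ∈ Metric.ball v (min η₁ η₂), w 0 ≠ 0 →
      blowupChart q z₀ L a b root w ∈ unramifiedLocus q := fun w hw hw0 =>
    h.mem_unramifiedLocus _ (h1 w (Metric.ball_subset_ball (min_le_left _ _) hw))
      fun h0 => hr0 w hw0 (congrFun h0 0)
  refine ⟨min η₁ η₂, lt_min hη₁ hη₂, ⟨Metric.isOpen_ball,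
    fun w _ => h.holMapAt_blowupChart hN hξ hC hroot hq ha hb w,
    {w | w ∈ Metric.ball v (min η₁ η₂) ∧ w 0 = 0}, ⟨fun w hw => hw.1, ?_, fun w hw =>
      ⟨_, Metric.isOpen_ball, hw, subset_rfl, 1, fun _ w => w 0,
        fun _ w _ => analyticAt_apply 0 w, ?_⟩⟩, ?_, ?_⟩, hunr⟩
  · have h3 : interior {w : C3 | w 0 = 0} = ∅ := by
      by_contra hne
      obtain ⟨w, hw⟩ := Set.nonempty_iff_ne_empty.2 hne
      have h4 := (isOpenMap_eval (X := fun _ : Fin 3 => ℂ) 0).image_mem_nhds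
        (mem_interior_iff_mem_nhds.1 hw)
      have h5 : Function.eval 0 '' {w : C3 | w 0 = 0} ⊆ {(0 : ℂ)} := by
        rintro _ ⟨u, hu, rfl⟩
        exact hu
      have h6 := mem_interior_iff_mem_nhds.2 (mem_of_superset h4 h5)
      rw [interior_singleton] at h6
      exact h6
    exact Set.subset_eq_empty (interior_mono fun w hw => hw.2) h3
  · ext u
    simp only [Set.mem_inter_iff, Set.mem_ofPred_eq]
    exact ⟨fun hu => ⟨hu.2, fun _ => hu.1.2⟩, fun hu => ⟨⟨hu.1, hu.2 0⟩, hu.1⟩⟩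
  · rintro w ⟨hw, hwA⟩ w' ⟨hw', hwA'⟩ heq
    have hw0 : w 0 ≠ 0 := fun h0 => hwA ⟨hw, h0⟩
    have hw0' : w' 0 ≠ 0 := fun h0 => hwA' ⟨hw', h0⟩
    obtain ⟨c, hc, hcx⟩ := h.exists_of_eq _ _
      (h1 w (Metric.ball_subset_ball (min_le_left _ _) hw))
      (h1 w' (Metric.ball_subset_ball (min_le_left _ _) hw')) heq
    have x0 : root (w 0) = c 0 * root (w' 0) := hcx 0
    have x1 : root (w 0) ^ a * w 1 = c 1 * (root (w' 0) ^ a * w' 1) := hcx 1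
    have x2 : root (w 0) ^ b * w 2 = c 2 * (root (w' 0) ^ b * w' 2) := hcx 2
    have hτ := hr0 w hw0
    have hτ' := hr0 w' hw0'
    have hc0 : c 0 ≠ 0 := fun h0 => hτ (by rw [x0, h0, zero_mul])
    have y1 : c 0 ^ a * w 1 = c 1 * w' 1 := by
      refine mul_left_cancel₀ (pow_ne_zero a hτ') ?_
      rw [x0, mul_pow] at x1
      linear_combination x1
    have y2 : c 0 ^ b * w 2 = c 2 * w' 2 := by
      refine mul_left_cancel₀ (pow_ne_zero b hτ') ?_
      rw [x0, mul_pow] at x2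
      linear_combination x2
    have hpair := h2 (w, w') (by
      rw [Metric.mem_ball, Prod.dist_eq]
      exact max_lt (Metric.ball_subset_ball (min_le_right _ _) hw)
        (Metric.ball_subset_ball (min_le_right _ _) hw'))
    have c1 := hpair.1 c hc y1
    have c2 := hpair.2 c hc y2
    rw [c1] at y1
    rw [c2] at y2
    ext i
    fin_cases i
    · show w 0 = w' 0
      rw [← hroot (w 0), x0, mul_pow, hI c hc c1 c2, one_mul, hroot]
    · exact mul_left_cancel₀ (pow_ne_zero a hc0) y1
    · exact mul_left_cancel₀ (pow_ne_zero b hc0) y2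
  · rintro w ⟨hw, hwA⟩
    exact hunr w hw fun h0 => hwA ⟨hw, h0⟩

omit hroot in
/-- The age criterion: the exceptional divisor of a weighted blow-up with weights `1, a, b` of a
canonical quotient singularity of index `N` has non-negative discrepancy. -/
theorem le_one_add_add (hcan : HasCanonicalSingularities q) {r : ℕ} (hr : 0 < r)
    (hgen : IsPluricanonicalGenerator q r Set.univ fun _ => 1)
    (hI : ∀ c ∈ C, c 1 = c 0 ^ a → c 2 = c 0 ^ b → c 0 ^ N = 1) : N ≤ 1 + a + b := by
  by_contra! hlt
  choose root hroot using fun t : ℂ => IsAlgClosed.exists_pow_nat_eq t hN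
  obtain ⟨η, hη, hbim, hunr⟩ :=
    h.exists_isBimeromorphicMorphism hq hN hξ hC ha hb hroot hI
  obtain ⟨k, hk, hkF⟩ := hcan.discrepancy_nonneg r Set.univ _ hr isOpen_univ hgen _ _ hbim
    (Set.mapsTo_univ _ _)
  set v : C3 := ![0, 1, 1]
  let path : ℂ → C3 := fun t => ![t, 1, 1]
  have hpath : ContinuousAt path 0 := by
    refine continuousAt_pi.2 fun i => ?_
    fin_cases i
    · exact continuousAt_id
    · exact continuousAt_const
    · exact continuousAt_const
  have hrc := tendsto_root_zero hN.ne' hroot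
  have hr0 : root 0 = 0 := by simpa [hN.ne'] using hroot 0
  -- If `N ≥ 2 + a + b`, the Jacobian times `root t` has absolute value `κ * ‖root t‖ ^ (2 + a + b -
  -- N) ≥ κ`. The extra factor `root t` makes the bounded extension `k` tend to zero after
  -- multiplication, which is the contradiction even in the borderline case `N = 2 + a + b`.
  let κ : ℝ := ‖(L : C3 →L[ℂ] C3).det‖ / N
  have hN' : (0 : ℝ) < N := by exact_mod_cast hN
  have hκ : 0 < κ := div_pos (norm_pos_iff.2 L.toLinearEquiv.isUnit_det'.ne_zero) hN'
  have hlim : Tendsto (fun t => k (path t) * root t ^ r) (𝓝 0) (𝓝 0) := by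
    have h1 : ContinuousAt (fun t => k (path t) * root t ^ r) 0 :=
      (ContinuousAt.comp (g := k) (hk v (Metric.mem_ball_self hη)).continuousAt hpath).mul
        (hrc.pow r)
    rw [ContinuousAt, hr0, zero_pow hr.ne', mul_zero] at h1
    exact h1
  have hev1 : ∀ᶠ t in 𝓝[≠] (0 : ℂ), ‖k (path t) * root t ^ r‖ < κ ^ r :=
    (hlim.norm.eventually_lt_const (by simpa using pow_pos hκ r)).filter_mono nhdsWithin_le_nhds
  have hev2 : ∀ᶠ t in 𝓝[≠] (0 : ℂ), path t ∈ Metric.ball v η :=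
    (hpath.eventually (Metric.ball_mem_nhds v hη)).filter_mono nhdsWithin_le_nhds
  have hev3 : ∀ᶠ t in 𝓝[≠] (0 : ℂ), ‖root t‖ < 1 :=
    (hrc.norm.eventually_lt_const (by simp [hr0])).filter_mono nhdsWithin_le_nhds
  obtain ⟨t, ht1, ht2, ht3, ht0⟩ := (hev1.and (hev2.and (hev3.and self_mem_nhdsWithin))).exists
  have ht0' : path t 0 ≠ 0 := ht0
  obtain ⟨F, hF, -, hdet⟩ := h.exists_lift hN hξ hC hroot ht0'
  have hkt := hkF (path t) ht2 (hunr _ ht2 ht0') F hF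
  refine absurd ht1 (not_lt.2 ?_)
  rw [hkt, one_mul, hdet, ← mul_pow, norm_pow]
  refine pow_le_pow_left₀ hκ.le ?_ r
  have hpos : 0 < ‖root t‖ := norm_pos_iff.2 fun h0 => ht0 (by
    rw [← hroot t, h0, zero_pow hN.ne']; rfl)
  have hnt : ‖t‖ = ‖root t‖ ^ N := by rw [← norm_pow, hroot]
  have hnorm : ‖(L : C3 →L[ℂ] C3).det * (root (path t 0) / (N * path t 0) * root (path t 0) ^ a *
      root (path t 0) ^ b) * root t‖ = κ * (‖root t‖ ^ (2 + a + b) / ‖root t‖ ^ N) := by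
    show ‖(L : C3 →L[ℂ] C3).det * (root t / (N * t) * root t ^ a * root t ^ b) * root t‖ = _
    simp only [norm_mul, norm_div, norm_pow, Complex.norm_natCast, hnt, κ]
    field_simp
    ring
  rw [hnorm]
  refine le_mul_of_one_le_right hκ.le ((one_le_div (pow_pos hpos N)).2 ?_)
  exact pow_le_pow_of_le_one hpos.le ht3.le (by omega)

end IsDiagonalModel

end Discrepancy

/-! ### Canonical singularities of torus quotients -/

namespace IsAffineAction

variable {Λ : Submodule ℤ C3} [DiscreteTopology Λ] {G : Type*} [Group G] [Finite G]
  [MulAction G (C3 ⧸ Λ)] {ρ : G →* Module.End ℂ C3} {b : G → C3} (hρ : IsAffineAction Λ ρ b)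
include hρ

lemma exists_injOn {z : C3} (hz : MulAction.stabilizer G (torusMk Λ z) = ⊥) :
    ∃ W ∈ 𝓝 z, Set.InjOn (torusQuotientMk Λ G) W := by
  obtain ⟨ε, hε, h⟩ := hρ.exists_ball_stabilizer z
  refine ⟨Metric.ball z ε, Metric.ball_mem_nhds z hε, fun x hx y hy hxy => ?_⟩
  obtain ⟨g, hg, hgx⟩ := h (x - z) (y - z) (by simpa [dist_eq_norm] using hx)
    (by simpa [dist_eq_norm] using hy) (by simpa using hxy)
  rw [hz, Subgroup.mem_bot] at hg
  rw [hg, map_one, Module.End.one_apply] at hgx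
  exact sub_left_injective hgx

lemma mem_unramifiedLocus {z : C3} (hz : MulAction.stabilizer G (torusMk Λ z) = ⊥) :
    torusQuotientMk Λ G z ∈ unramifiedLocus (torusQuotientMk Λ G) := by
  intro w hw
  obtain ⟨g, hg⟩ := torusQuotientMk_eq_iff.1 hw
  refine hρ.exists_injOn ?_
  rw [← hg, MulAction.stabilizer_smul_eq_stabilizer_map_conj, hz, Subgroup.map_bot]

lemma stabilizer_eq_bot_of_norm_lt (hfix : HasFiniteFixedLocus Λ G) (z₀ : C3) :
    ∃ ε > 0, ∀ x : C3, ‖x‖ < ε → x ≠ 0 →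
      MulAction.stabilizer G (torusMk Λ (z₀ + x)) = ⊥ := by
  obtain ⟨ε, hε, h⟩ := hρ.exists_ball_smul_eq z₀
  refine ⟨ε, hε, fun x hx hx0 => (Subgroup.eq_bot_iff_forall _).2 fun g hg => ?_⟩
  by_contra hg1
  obtain ⟨hs, hgx⟩ := h x x hx hx g hg
  exact hx0 (hρ.eq_zero_of_fixed hfix hs hg1 hgx.symm)

omit [DiscreteTopology Λ] [Finite G] in
-- Over the unramified locus, a local lift of `q` through itself coincides with an affine deck
-- transformation. Its determinant has trivial `|G|`-th power, so `(dz₁ ∧ dz₂ ∧ dz₃) ^ |G|` is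
-- invariant.
lemma isPluricanonicalGenerator :
    IsPluricanonicalGenerator (torusQuotientMk Λ G) (Nat.card G) Set.univ fun _ => 1 where
  holomorphic _ _ := analyticAt_const
  ne_zero _ _ := one_ne_zero
  invariant := by
    rintro z ⟨-, hz⟩ F ⟨hFa, hF⟩
    obtain ⟨g, c, hgz, hgq⟩ := hρ.exists_affine_deck (z := F z) (w := z) hF.self_of_nhds
    obtain ⟨W, hW, hinj⟩ := hz (F z) hF.self_of_nhds
    let A := LinearMap.toContinuousLinearMap (ρ g)
    have hA : HasFDerivAt (fun x => A x + c) A z := A.hasFDerivAt.add_const c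
    have hAz : A z + c = F z := hgz
    have hAc : Tendsto (fun x => A x + c) (𝓝 z) (𝓝 (F z)) := hAz ▸ hA.continuousAt.tendsto
    have heq : F =ᶠ[𝓝 z] fun x => A x + c := by
      filter_upwards [hF, hFa.continuousAt.eventually hW, hAc.eventually hW] with x h1 h2 h3
      exact hinj h2 h3 (h1.trans (hgq x).symm)
    rw [heq.fderiv_eq, hA.fderiv, one_mul]
    show LinearMap.det (ρ g) ^ Nat.card G = 1
    rw [← map_pow, ← map_pow, pow_card_eq_one', map_one, map_one]

variable {z₀ : C3} {g : MulAction.stabilizer G (torusMk Λ z₀)}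
  (hg : ∀ h, h ∈ Submonoid.powers g) {L : C3 ≃L[ℂ] C3} {ζ : ℂ} {a : Fin 3 → ℕ}
  (hL : ∀ x, ρ g (L x) = L fun i => ζ ^ a i * x i)

omit [DiscreteTopology Λ] [Finite G] hρ in
include hL in
lemma pow_apply_diagonal (m : ℕ) (x : C3) :
    ρ (g ^ m : MulAction.stabilizer G (torusMk Λ z₀)) (L x) =
      L fun i => (ζ ^ m) ^ a i * x i := by
  induction m generalizing x with
  | zero => simp
  | succ m ih =>
    rw [pow_succ, Subgroup.coe_mul, map_mul, Module.End.mul_apply, hL, ih]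
    congr 1
    ext i
    rw [pow_succ, mul_pow, mul_assoc]

include hg hL in
lemma exists_isDiagonalModel (hfix : HasFiniteFixedLocus Λ G) (hζ : IsOfFinOrder ζ) :
    ∃ ε, IsDiagonalModel (torusQuotientMk Λ G) z₀ L
      (Set.range fun m : ℕ => fun i => (ζ ^ m) ^ a i) ε := by
  obtain ⟨ε₁, hε₁, h₁⟩ := hρ.exists_ball_stabilizer z₀
  obtain ⟨ε₂, hε₂, h₂⟩ := hρ.stabilizer_eq_bot_of_norm_lt hfix z₀
  obtain ⟨ε, hε, hball⟩ := Metric.continuousAt_iff.1 (L.continuous.continuousAt (x := 0)) _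
    (lt_min hε₁ hε₂)
  have hlt : ∀ x : C3, ‖x‖ < ε → ‖L x‖ < min ε₁ ε₂ := fun x hx => by
    simpa using hball (x := x) (by simpa using hx)
  refine ⟨ε, hε, ?_, fun x y hx hy hxy => ?_, ?_, fun x hx hx0 => ?_⟩
  · have : (Set.range fun m : ℕ => ζ ^ m).Finite := by
      have := hζ.finite_powers
      rwa [Submonoid.coe_powers] at this
    refine (this.image fun t i => t ^ a i).subset ?_
    rintro _ ⟨m, rfl⟩
    exact ⟨ζ ^ m, ⟨m, rfl⟩, rfl⟩
  · obtain ⟨k, hk, hkx⟩ := h₁ (L x) (L y) ((hlt x hx).trans_le (min_le_left _ _))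
      ((hlt y hy).trans_le (min_le_left _ _)) hxy
    obtain ⟨m, hm⟩ := hg ⟨k, hk⟩
    have h1 := pow_apply_diagonal hL m y
    rw [show g ^ m = ⟨k, hk⟩ from hm, ← hkx] at h1
    exact ⟨_, ⟨m, rfl⟩, fun i => congrFun (L.injective h1) i⟩
  · rintro _ ⟨m, rfl⟩ x
    rw [← pow_apply_diagonal hL m x]
    exact hρ.torusQuotientMk_eq_of_stabilizer (g ^ m).2 _
  · refine hρ.mem_unramifiedLocus (h₂ _ ((hlt x hx).trans_le (min_le_right _ _)) ?_)
    simpa using hx0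

include hg hL in
-- The inequality `N ≤ 1 + a + b` fails for the generator in all non-canonical types but 1/18 (1, 7,
-- 13), where a power of the generator is used instead.
lemma mem_canonicalTypes (hfix : HasFiniteFixedLocus Λ G)
    (hcan : HasCanonicalSingularities (torusQuotientMk Λ G)) {d : ℕ} (hd : 0 < d)
    (hζ : IsPrimitiveRoot ζ d) (ha : (d, a) ∈ canonicalTypes ++ noncanonicalTypes) :
    (d, a) ∈ canonicalTypes := by
  refine (List.mem_append.1 ha).resolve_right fun hnon => ?_
  obtain ⟨ε, h⟩ := hρ.exists_isDiagonalModel hg hL hfix (isOfFinOrder_iff_pow_eq_one.2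
    ⟨d, hd, hζ.pow_eq_one⟩)
  have hage : ∀ {N m n l : ℕ} {ξ : ℂ}, 0 < N → IsPrimitiveRoot ξ N →
      (fun i => (ζ ^ l) ^ a i) = ![ξ, ξ ^ m, ξ ^ n] → m ≠ 0 → n ≠ 0 →
      (∀ k : ℕ, (ζ ^ k) ^ a 1 = ((ζ ^ k) ^ a 0) ^ m → ((ζ ^ k) ^ a 0) ^ N = 1) →
      N ≤ 1 + m + n := by
    intro N m n l ξ hN hξ hl hm hn hI
    refine h.le_one_add_add continuous_torusQuotientMk hN hξ ⟨l, hl⟩ hm hn hcan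
      Nat.card_pos hρ.isPluricanonicalGenerator ?_
    rintro _ ⟨k, rfl⟩ h1 -
    exact hI k h1
  have hage1 : ∀ m n : ℕ, a = ![1, m, n] → m ≠ 0 → n ≠ 0 → d ≤ 1 + m + n := by
    rintro m n rfl hm hn
    refine hage (l := 1) hd hζ ?_ hm hn fun k _ => ?_
    · ext i
      fin_cases i <;> simp
    · simp only [Matrix.cons_val_zero, pow_one]
      rw [pow_right_comm, hζ.pow_eq_one, one_pow]
  simp only [noncanonicalTypes, List.mem_cons, Prod.mk.injEq, List.not_mem_nil, or_false] at hnon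
  rcases hnon with ⟨rfl, hd_a⟩ | ⟨rfl, hd_a⟩ | ⟨rfl, hd_a⟩ | ⟨rfl, hd_a⟩ | ⟨rfl, hd_a⟩ | ⟨rfl, hd_a⟩ | ⟨rfl, rfl⟩
  iterate 6
    have := hage1 _ _ hd_a (by norm_num) (by norm_num)
    omega
  have h18 := hζ.pow_eq_one
  -- Here 1 + 7 + 13 ≥ 18, so the generator gives nothing. Its cube, however, has exponents 3, 21,
  -- 39, all congruent to 3 modulo 18: it is a scalar of order 6, and 6 > 1 + 1 + 1.
  have hξ : IsPrimitiveRoot (ζ ^ 3) 6 := hζ.pow (by norm_num) (by norm_num)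
  have := hage (N := 6) (m := 1) (n := 1) (l := 3) (by norm_num) hξ ?_ one_ne_zero one_ne_zero ?_
  · omega
  · ext i
    fin_cases i
    · simp
    · show (ζ ^ 3) ^ 7 = (ζ ^ 3) ^ 1
      linear_combination ζ ^ 3 * h18
    · show (ζ ^ 3) ^ 13 = (ζ ^ 3) ^ 1
      linear_combination (ζ ^ 21 + ζ ^ 3) * h18
  -- An element whose first two entries agree satisfies `ζ ^ (7 k) = ζ ^ k`, hence has first entry
  -- of order dividing 6.
  · intro k hk
    have h1 : (ζ ^ k) ^ 7 = ((ζ ^ k) ^ 1) ^ 1 := hk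
    show ((ζ ^ k) ^ 1) ^ 6 = 1
    have h0 : ζ ^ k ≠ 0 := pow_ne_zero _ (hζ.ne_zero (by norm_num))
    refine mul_left_cancel₀ h0 ?_
    linear_combination h1

end IsAffineAction

theorem theorem3p3 (Λ : Submodule ℤ C3) [DiscreteTopology Λ] [IsZLattice ℝ Λ]
    (G : Type*) [Group G] [Finite G] [MulAction G (C3 ⧸ Λ)]
    (hhol : IsHolomorphicAction Λ G) (htrans : IsTranslationFree Λ G)
    (hfix : HasFiniteFixedLocus Λ G)
    (hcan : HasCanonicalSingularities (torusQuotientMk Λ G)) :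
    -- all stabilizers are cyclic, of one of the listed orders
    (∀ p : C3 ⧸ Λ, IsCyclic (MulAction.stabilizer G p) ∧
      Nat.card (MulAction.stabilizer G p) ∈ ({1, 2, 3, 4, 6, 7, 9, 14} : Set ℕ)) ∧
    -- the singularities of the quotient are isolated
    (∀ x : TorusQuotient Λ G, ∀ᶠ y in 𝓝[≠] x, SmoothPoint (torusQuotientMk Λ G) y) ∧
    -- the images of points with trivial stabilizer are smooth
    (∀ p : C3 ⧸ Λ, MulAction.stabilizer G p = ⊥ →
      SmoothPoint (torusQuotientMk Λ G) (orbitMk Λ G p)) ∧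
    -- the images of all other points are cyclic quotient singularities of the listed types
    (∀ p : C3 ⧸ Λ, MulAction.stabilizer G p ≠ ⊥ →
      ∃ (d : ℕ) (a : Fin 3 → ℕ), d = Nat.card (MulAction.stabilizer G p) ∧
        ((d, a) ∈ ({(2, ![1, 1, 1]), (3, ![1, 1, 2]), (4, ![1, 1, 3]), (6, ![1, 1, 5]),
          (3, ![1, 1, 1]), (7, ![1, 2, 4]), (9, ![1, 4, 7]), (14, ![1, 9, 11])} :
            Set (ℕ × (Fin 3 → ℕ)))) ∧
        IsCyclicQuotientPoint (torusQuotientMk Λ G) (orbitMk Λ G p) d a) := by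
  obtain ⟨ρ, b, hρ⟩ := exists_isAffineAction hhol
  have key : ∀ p : C3 ⧸ Λ, MulAction.stabilizer G p ≠ ⊥ →
      ∃ a : Fin 3 → ℕ, (Nat.card (MulAction.stabilizer G p), a) ∈ canonicalTypes ∧
        IsCyclicQuotientPoint (torusQuotientMk Λ G) (orbitMk Λ G p)
          (Nat.card (MulAction.stabilizer G p)) a := by
    intro p hp
    obtain ⟨z₀, rfl⟩ := torusMk_surjective p
    have : Nontrivial (MulAction.stabilizer G (torusMk Λ z₀)) :=
      (Subgroup.nontrivial_iff_ne_bot _).2 hp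
    obtain ⟨g, L, a, hg, -, ha, hL⟩ := (hρ.isFreeIntegralRep hfix z₀).exists_normal_form
    have hd : 0 < Nat.card (MulAction.stabilizer G (torusMk Λ z₀)) := Nat.card_pos
    have hζ := Complex.isPrimitiveRoot_exp _ hd.ne'
    exact ⟨a, hρ.mem_canonicalTypes hg hL hfix hcan hd hζ ha,
      hρ.isCyclicQuotientPoint hd hg L hζ hL⟩
  refine ⟨fun p => ?_, hρ.eventually_smoothPoint hfix,
    fun p hp => hρ.smoothPoint_of_stabilizer_eq_bot hp, fun p hp => ?_⟩
  · by_cases hp : MulAction.stabilizer G p = ⊥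
    · rw [hp]
      exact ⟨inferInstance, by simp⟩
    · obtain ⟨a, ha, -⟩ := key p hp
      obtain ⟨z₀, rfl⟩ := torusMk_surjective p
      refine ⟨(hρ.isFreeIntegralRep hfix z₀).isCyclic, ?_⟩
      simp only [canonicalTypes, List.mem_cons, Prod.mk.injEq, List.not_mem_nil, or_false] at ha
      simp only [Set.mem_insert_iff, Set.mem_singleton_iff]
      tauto
  · obtain ⟨a, ha, h⟩ := key p hp
    refine ⟨_, a, rfl, ?_, h⟩
    simpa only [canonicalTypes, List.mem_cons, List.not_mem_nil, or_false, Set.mem_insert_iff,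
      Set.mem_singleton_iff] using ha
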